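/- Let $N\ge 3$ buyers have independent private values $X_1,\dots,X_N\ge 0$ for an indivisible good, each with distribution $F$ with support $[\underline x,\bar x]$, $\underline x\ge 0$, and a density $f$ that is continuous on $[\underline x,\bar x]$. Suppose that the virtual valuation $\psi(x)=x-\frac{1-F(x)}{f(x)}$ is (weakly) increasing on $[\underline x,\bar x]$ (with $c/0=\infty$ for $c>0$ and $0/0=0$). Each buyer wants one unit. Two sellers sell one identical unit each, one after the other; the second one uses a second-price auction without a (binding) reserve price, in which all buyers who did not obtain the first unit bid their values, so that a buyer $i$ without the first unit gets the continuation payoff $\max\{x_i-\max_j x_j,0\}$, where $j$ ranges over the other buyers who did not obtain the first unit. For a vector $b$ write $b_{(k)}$ for its $k$-th highest entry, and for $x\in[\underline x,\bar x]$ let $a(x)=\min\{a\in[\underline x,\bar x]: a\ge x,\ a+\psi(a)\ge x\}$. The modified third-price auction of the first unit is the following: each buyer submits a bid in $[\underline x,\bar x]$. If $b_{(2)}\ge a(b_{(3)})$, the unit is allocated to the second-highest bidder; otherwise it is not allocated and no one pays. If it is allocated, then: when $\psi(b_{(3)})\ge 0$, the second-highest bidder pays $b_{(3)}$ and the others pay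 nothing; when $\psi(b_{(3)})<0$, the highest bidder pays $a(b_{(3)})-b_{(3)}$, the second-highest bidder pays $a(b_{(3)})$, and the others pay nothing. Ties are broken by a priority order on the buyers that is drawn from any fixed distribution independent of the values and bids (for example uniformly). A direct mechanism for the first seller consists of measurable allocation probabilities $P_i(x)\ge0$ with $\sum_i P_i(x)\le 1$ and measurable transfers $t_i(x)$ from the buyers, as functions of the reports $x\in[\underline x,\bar x]^N$, with well-defined ex ante and interim expected transfers. It is feasible if truthful reporting is a Bayesian Nash equilibrium (incentive compatibility) and every type of every buyer gets at least the expected payoff that he would get in the second auction if the first unit were allocated to no one (individual rationality). Then: 1. Truthful bidding is an ex post equilibrium of the modified third-price auction: for every profile of values, no buyer can raise his payoff over both periods (expected over the tie-breaking) by another bid in $[\underline x,\bar x]$. It is also a Bayesian Nash equilibrium. 2. In this equilibrium the expected revenue of the first seller is $E\max\{\psi(X_{(2)})+X_{(2)}-X_{(3)},0\}$, and this expectation is finite. 3. This is the optimal expected revenue: the modified third-price auction with truthful bidding is a feasible direct mechanism, and no feasible direct mechanism has a higher expected revenue. -/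

import Mathlib

open MeasureTheory ProbabilityTheory Set

noncomputable section

namespace SequentialAuction

/-- `μ` is a distribution of buyer values with support `[lo, hi]`, `lo ≥ 0`, and density `f`
(with respect to Lebesgue measure) that is continuous on `[lo, hi]`. -/
structure IsValueDistribution (μ : Measure ℝ) (f : ℝ → ℝ) (lo hi : ℝ) : Prop where
  isProbabilityMeasure : IsProbabilityMeasure μ
  lo_nonneg : 0 ≤ lo
  support_eq : μ.support = Icc lo hi
  density_nonneg : ∀ x, 0 ≤ f x
  density_eq_zero : ∀ x, x ∉ Icc lo hi → f x = 0
  density_continuousOn : ContinuousOn f (Icc lo hi)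
  eq_withDensity : μ = volume.withDensity (fun x => ENNReal.ofReal (f x))

/-- The virtual valuation `ψ x = x - (1 - F x) / f x`. The quotient is taken in `[0, ∞]`, where
`c / 0 = ∞` for `c ≠ 0` and `0 / 0 = 0`, so that `ψ x = -∞` where the density vanishes and
`F x < 1`, and `ψ x = x` where `F x = 1`. -/
def virtualValue (μ : Measure ℝ) (f : ℝ → ℝ) (x : ℝ) : EReal :=
  (x : EReal) - ((ENNReal.ofReal (1 - cdf μ x) / ENNReal.ofReal (f x) : ENNReal) : EReal)

/-- The threshold `a x = min {a ≥ x : a + ψ a ≥ x}`, where `a` ranges over `[lo, hi]`. -/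
def threshold (ψ : ℝ → EReal) (lo hi x : ℝ) : ℝ :=
  sInf {a : ℝ | a ∈ Icc lo hi ∧ x ≤ a ∧ (x : EReal) ≤ (a : EReal) + ψ a}

/-- The `k`-th highest of the numbers `b 0, …, b (N - 1)` (for `1 ≤ k ≤ N`): the largest `c` such
that at least `k` of them are at least `c`. -/
def kthHighest {N : ℕ} (b : Fin N → ℝ) (k : ℕ) : ℝ :=
  sSup {c : ℝ | k ≤ (Finset.univ.filter fun j => c ≤ b j).card}

/-- Bidder `j` is ranked above bidder `i`: a higher bid, or an equal bid and an earlier place in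
the priority order `σ`. -/
def RankedAbove {N : ℕ} (σ : Equiv.Perm (Fin N)) (b : Fin N → ℝ) (j i : Fin N) : Prop :=
  b i < b j ∨ (b i = b j ∧ σ j < σ i)

open Classical in
/-- The position of bidder `i` in the ranking: `1` for the highest bidder, `2` for the
second-highest bidder, and so on. -/
def position {N : ℕ} (σ : Equiv.Perm (Fin N)) (b : Fin N → ℝ) (i : Fin N) : ℕ :=
  (Finset.univ.filter fun j => RankedAbove σ b j i).card + 1

/-- A mechanism for the first unit, in which every buyer submits a number: the probability
`alloc b i` that buyer `i` receives the unit and the expected payment `pay b i` of buyer `i` to the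
first seller, as functions of the vector `b` of submitted numbers. -/
structure Mechanism (N : ℕ) where
  alloc : (Fin N → ℝ) → Fin N → ℝ
  pay : (Fin N → ℝ) → Fin N → ℝ

/-- The second-period payoff of buyer `i`, who did not get the first unit, when `w` says who got
the first unit (`none` if it was withheld): the second unit is sold in a second-price auction with
reserve price zero, in which all buyers without a unit bid their true values `x`. -/
def secondPeriodPayoff {N : ℕ} (x : Fin N → ℝ) (i : Fin N) (w : Option (Fin N)) : ℝ :=
  max (x i - ⨆ j : {j : Fin N // j ≠ i ∧ w ≠ some j}, x j) 0

/-- The expected payoff of buyer `i` over both periods, before payments to the first seller, when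
the true values are `x` and buyer `j` gets the first unit with probability `p j`. -/
def grossPayoff {N : ℕ} (p : Fin N → ℝ) (x : Fin N → ℝ) (i : Fin N) : ℝ :=
  p i * x i + ∑ j ∈ Finset.univ.erase i, p j * secondPeriodPayoff x i (some j)
    + (1 - ∑ j, p j) * secondPeriodPayoff x i none

/-- The expected net payoff of buyer `i` when the numbers `b` are submitted and the true values
are `x`. -/
def payoff {N : ℕ} (M : Mechanism N) (b x : Fin N → ℝ) (i : Fin N) : ℝ :=
  grossPayoff (M.alloc b) x i - M.pay b i

/-- The strategy profile `β` (buyer `j` with value `v` submits `β j v`) is an ex post equilibrium: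
at every profile of values, no buyer gains by submitting another number in `[lo, hi]`. -/
def IsExPostEquilibrium {N : ℕ} (lo hi : ℝ) (M : Mechanism N) (β : Fin N → ℝ → ℝ) : Prop :=
  ∀ x : Fin N → ℝ, (∀ j, x j ∈ Icc lo hi) → ∀ i, ∀ q ∈ Icc lo hi,
    payoff M (Function.update (fun j => β j (x j)) i q) x i ≤ payoff M (fun j => β j (x j)) x i

/-- The interim expected payoff of buyer `i` with value `v` who submits `q` when the rivals, whose
values are independent with law `μ`, follow `β`. (The `i`-th coordinate of the sampled vector is
overwritten.) -/
def interimPayoff {N : ℕ} (μ : Measure ℝ) (M : Mechanism N) (β : Fin N → ℝ → ℝ)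
    (i : Fin N) (v q : ℝ) : ℝ :=
  ∫ x, payoff M (Function.update (fun j => β j (x j)) i q) (Function.update x i v) i
    ∂(Measure.pi fun _ : Fin N => μ)

/-- The strategy profile `β` is a Bayesian Nash equilibrium. -/
def IsBayesNashEquilibrium {N : ℕ} (μ : Measure ℝ) (lo hi : ℝ) (M : Mechanism N)
    (β : Fin N → ℝ → ℝ) : Prop :=
  ∀ i, ∀ v ∈ Icc lo hi, ∀ q ∈ Icc lo hi,
    interimPayoff μ M β i v q ≤ interimPayoff μ M β i v (β i v)

/-- Every buyer submits his true value. -/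
def truthful (N : ℕ) : Fin N → ℝ → ℝ := fun _ v => v

/-- `M` is a direct mechanism on reports in `[lo, hi]`, with well-defined expected transfers. -/
structure IsDirectMechanism {N : ℕ} (μ : Measure ℝ) (lo hi : ℝ) (M : Mechanism N) : Prop where
  measurable_alloc : ∀ i, Measurable fun b => M.alloc b i
  measurable_pay : ∀ i, Measurable fun b => M.pay b i
  alloc_nonneg : ∀ b, (∀ j, b j ∈ Icc lo hi) → ∀ i, 0 ≤ M.alloc b i
  sum_alloc_le_one : ∀ b, (∀ j, b j ∈ Icc lo hi) → ∑ i, M.alloc b i ≤ 1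
  integrable_pay : ∀ i, Integrable (fun x => M.pay x i) (Measure.pi fun _ : Fin N => μ)
  integrable_interim_pay : ∀ i, ∀ q ∈ Icc lo hi,
    Integrable (fun x => M.pay (Function.update x i q) i) (Measure.pi fun _ : Fin N => μ)

/-- Individual rationality: each type of each buyer gets at least the expected payoff from the
second auction when the first unit is allocated to no one. -/
def IsIndividuallyRational {N : ℕ} (μ : Measure ℝ) (lo hi : ℝ) (M : Mechanism N) : Prop :=
  ∀ i, ∀ v ∈ Icc lo hi,
    ∫ x, secondPeriodPayoff (Function.update x i v) i none ∂(Measure.pi fun _ : Fin N => μ)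
      ≤ interimPayoff μ M (truthful N) i v v

/-- The mechanisms among which the first seller chooses: incentive compatible and individually
rational direct mechanisms. -/
structure IsFeasible {N : ℕ} (μ : Measure ℝ) (lo hi : ℝ) (M : Mechanism N) : Prop where
  isDirectMechanism : IsDirectMechanism μ lo hi M
  incentiveCompatible : IsBayesNashEquilibrium μ lo hi M (truthful N)
  individuallyRational : IsIndividuallyRational μ lo hi M

/-- The expected revenue of the first seller when all buyers submit their values. -/
def expectedRevenue {N : ℕ} (μ : Measure ℝ) (M : Mechanism N) : ℝ :=
  ∫ x, ∑ i, M.pay x i ∂(Measure.pi fun _ : Fin N => μ)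

/-- In the modified third-price auction the first unit is allocated at bids `b` if and only if
the second-highest bid is at least the threshold of the third-highest bid. -/
def IsAllocated {N : ℕ} (ψ : ℝ → EReal) (lo hi : ℝ) (b : Fin N → ℝ) : Prop :=
  threshold ψ lo hi (kthHighest b 3) ≤ kthHighest b 2

open Classical in
/-- Allocation in the modified third-price auction, ties being broken by the priority order `σ`:
the unit goes to the second-highest bidder if it is allocated. -/
def thirdPriceAlloc {N : ℕ} (ψ : ℝ → EReal) (lo hi : ℝ) (σ : Equiv.Perm (Fin N))
    (b : Fin N → ℝ) (i : Fin N) : ℝ :=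
  if IsAllocated ψ lo hi b ∧ position σ b i = 2 then 1 else 0

open Classical in
/-- Payments in the modified third-price auction, ties being broken by the priority order `σ`. -/
def thirdPricePay {N : ℕ} (ψ : ℝ → EReal) (lo hi : ℝ) (σ : Equiv.Perm (Fin N))
    (b : Fin N → ℝ) (i : Fin N) : ℝ :=
  if IsAllocated ψ lo hi b then
    if position σ b i = 1 then
      (if ψ (kthHighest b 3) < 0 then threshold ψ lo hi (kthHighest b 3) - kthHighest b 3 else 0)
    else if position σ b i = 2 then
      (if ψ (kthHighest b 3) < 0 then threshold ψ lo hi (kthHighest b 3) else kthHighest b 3)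
    else 0
  else 0

/-- The modified third-price auction, where the priority order that breaks ties is drawn with
probabilities `τ` (uniform `τ`: ties are broken uniformly at random). -/
def modifiedThirdPriceAuction {N : ℕ} (ψ : ℝ → EReal) (lo hi : ℝ)
    (τ : Equiv.Perm (Fin N) → ℝ) : Mechanism N where
  alloc b i := ∑ σ, τ σ * thirdPriceAlloc ψ lo hi σ b i
  pay b i := ∑ σ, τ σ * thirdPricePay ψ lo hi σ b i

/-- The integrand `max {ψ x₍₂₎ + x₍₂₎ - x₍₃₎, 0}` of the optimal expected revenue. -/
def optimalRevenueAt {N : ℕ} (ψ : ℝ → EReal) (x : Fin N → ℝ) : ℝ :=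
  (max (ψ (kthHighest x 2) + ((kthHighest x 2 - kthHighest x 3 : ℝ) : EReal)) 0).toReal

end SequentialAuction

end

/-! Equilibrium. Fix a priority order and let `y₁ ≥ y₂` be the two highest values among the rivals
of buyer `i`. Whatever he bids, his payoff over both periods is at most `max (xᵢ - min (a y₂) y₁)
0`, and truth attains this bound (`payoff_priorityAuction_le`). The payments are designed for this.
If the top bidder lets the runner-up take the first unit, he obtains the second unit at `y₂` and has
paid `a y₂ - y₂`, so either route to a unit by way of the first auction costs `a y₂` in total, while
waiting after no sale costs `y₁`. Averaging over priority orders preserves the inequality, and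
integrating over values turns ex post incentives into interim ones.

Revenue. The derivative of a buyer's gross payoff in his own value is the probability that he ends
up with one of the two units (`winProb`). Incentive compatibility makes the interim version of this
a subgradient of the interim payoff, so the envelope formula and Fubini express expected revenue as
expected virtual surplus minus the payoffs of the lowest types. The mechanism that never sells earns
zero and leaves the lowest types zero, so the expected virtual surplus of never selling vanishes.
Only the gain over never selling therefore matters (`expectedRevenue_eq`).

Optimality. The virtual surplus is affine in the allocation probabilities. At a profile without
ties, giving the unit to the highest or to the second-highest buyer gains the same amount `R = ψ
x₍₂₎ + x₍₂₎ - x₍₃₎`: in both cases the top two buyers end up with the two units. Giving it to a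
lower buyer `l` gains only `ψ x_l ≤ ψ x₍₂₎ ≤ R`. Hence no allocation gains more than `max R 0`.
Monotonicity of `ψ` makes the threshold rule sell exactly when `R ≥ 0`, outside a null set, so the
auction attains this bound (`virtualSurplus_le_optimalRevenueAt`). Its lowest types get zero, while
individual rationality gives them at least zero in any feasible mechanism. -/

noncomputable section

namespace SequentialAuction

/-! ### Ranking of the bidders -/

section Ranking

variable {N : ℕ} {σ : Equiv.Perm (Fin N)} {b x : Fin N → ℝ} {i j k l : Fin N}

/-- A key in a linear order by which the bidders are ranked. -/
def rankKey (σ : Equiv.Perm (Fin N)) (b : Fin N → ℝ) (i : Fin N) : Lex (ℝ × (Fin N)ᵒᵈ) :=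
  toLex (b i, OrderDual.toDual (σ i))

lemma rankedAbove_iff : RankedAbove σ b j i ↔ rankKey σ b i < rankKey σ b j := by
  simp [RankedAbove, rankKey, Prod.Lex.toLex_lt_toLex]

lemma rankKey_injective : Function.Injective (rankKey σ b) := by
  intro i j h
  have h2 : OrderDual.toDual (σ i) = OrderDual.toDual (σ j) :=
    congrArg (fun p => (ofLex p).2) h
  exact σ.injective (OrderDual.toDual.injective h2)

lemma RankedAbove.trans (h₁ : RankedAbove σ b i j) (h₂ : RankedAbove σ b j k) :
    RankedAbove σ b i k := by
  rw [rankedAbove_iff] at *; exact h₂.trans h₁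

lemma RankedAbove.not_symm (h : RankedAbove σ b i j) : ¬ RankedAbove σ b j i := by
  rw [rankedAbove_iff] at *; exact h.not_gt

lemma not_rankedAbove_self : ¬ RankedAbove σ b i i := by
  rw [rankedAbove_iff]; exact lt_irrefl _

lemma RankedAbove.ne (h : RankedAbove σ b i j) : i ≠ j := by
  rintro rfl; exact not_rankedAbove_self h

lemma rankedAbove_or (h : i ≠ j) : RankedAbove σ b i j ∨ RankedAbove σ b j i := by
  rw [rankedAbove_iff, rankedAbove_iff]
  exact (lt_or_gt_of_ne (rankKey_injective.ne h)).symm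

lemma RankedAbove.le (h : RankedAbove σ b i j) : b j ≤ b i := by
  rcases h with h | ⟨h, -⟩
  exacts [h.le, h.le]

lemma rankedAbove_of_lt (h : b j < b i) : RankedAbove σ b i j := Or.inl h

lemma rankedAbove_congr {b' : Fin N → ℝ} (hi : b i = b' i) (hj : b j = b' j) :
    RankedAbove σ b i j ↔ RankedAbove σ b' i j := by
  simp [RankedAbove, hi, hj]

/-- A nonempty set of bidders has a highest-ranked member. -/
lemma exists_top (σ : Equiv.Perm (Fin N)) (b : Fin N → ℝ) {s : Finset (Fin N)}
    (hs : s.Nonempty) : ∃ i ∈ s, ∀ l ∈ s, l ≠ i → RankedAbove σ b i l := by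
  obtain ⟨i, hi, h⟩ := s.exists_max_image (rankKey σ b) hs
  refine ⟨i, hi, fun l hl hne => ?_⟩
  rw [rankedAbove_iff]
  exact lt_of_le_of_ne (h l hl) (rankKey_injective.ne hne)

lemma position_eq_card_add_one {s : Finset (Fin N)} (h : ∀ l, RankedAbove σ b l i ↔ l ∈ s) :
    position σ b i = s.card + 1 := by
  classical
  unfold position
  congr 2
  ext l
  simp [h]

lemma position_eq_one (h : ∀ l, l ≠ i → RankedAbove σ b i l) : position σ b i = 1 := by
  rw [position_eq_card_add_one (s := ∅)]
  · simp
  · intro l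
    simp only [Finset.notMem_empty, iff_false]
    by_cases hl : l = i
    · subst hl; exact not_rankedAbove_self
    · exact (h l hl).not_symm

lemma position_eq_two (hij : RankedAbove σ b i j)
    (h : ∀ l, l ≠ i → l ≠ j → RankedAbove σ b j l) : position σ b j = 2 := by
  rw [position_eq_card_add_one (s := {i})]
  · simp
  · intro l
    simp only [Finset.mem_singleton]
    constructor
    · intro hl
      by_contra hne
      exact hl.not_symm (h l hne hl.ne)
    · rintro rfl; exact hij

lemma position_eq_three (hij : RankedAbove σ b i j) (hjk : RankedAbove σ b j k)
    (h : ∀ l, l ≠ i → l ≠ j → l ≠ k → RankedAbove σ b k l) : position σ b k = 3 := by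
  rw [position_eq_card_add_one (s := {i, j})]
  · rw [Finset.card_pair hij.ne]
  · intro l
    simp only [Finset.mem_singleton, Finset.mem_insert]
    constructor
    · intro hl
      by_contra! hne
      exact hl.not_symm (h l hne.1 hne.2 hl.ne)
    · rintro (rfl | rfl)
      exacts [hij.trans hjk, hjk]

lemma position_lt (h : RankedAbove σ b i j) : position σ b i < position σ b j := by
  classical
  unfold position
  rw [Nat.add_lt_add_iff_right]
  refine Finset.card_lt_card (Finset.ssubset_iff_of_subset ?_ |>.2 ⟨i, ?_, ?_⟩)
  · intro l hl
    simp only [Finset.mem_filter, Finset.mem_univ, true_and] at hl ⊢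
    exact hl.trans h
  · simpa using h
  · simpa using not_rankedAbove_self

lemma position_injective : Function.Injective (position σ b) := by
  intro i j h
  by_contra hne
  rcases rankedAbove_or (σ := σ) (b := b) hne with h' | h'
  · exact (position_lt h').ne h
  · exact (position_lt h').ne h.symm

/-- `k`-th highest bid is the bid of the bidder in position `k`. -/
lemma kthHighest_eq_of_position {n : ℕ} (h : position σ b i = n) : kthHighest b n = b i := by
  classical
  refine IsGreatest.csSup_eq ⟨?_, ?_⟩
  · have hi : i ∉ Finset.univ.filter fun j => RankedAbove σ b j i := by
      simpa using not_rankedAbove_self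
    show n ≤ _
    rw [← h]
    unfold position
    rw [← Finset.card_insert_of_notMem hi]
    refine Finset.card_le_card fun l hl => ?_
    simp only [Finset.mem_insert, Finset.mem_filter, Finset.mem_univ, true_and] at hl ⊢
    rcases hl with rfl | hl
    exacts [le_rfl, hl.le]
  · intro c hc
    by_contra! hlt
    have hc' : n ≤ (Finset.univ.filter fun j => c ≤ b j).card := hc
    have : (Finset.univ.filter fun j => c ≤ b j).card
        ≤ (Finset.univ.filter fun j => RankedAbove σ b j i).card := by
      refine Finset.card_le_card fun l hl => ?_
      simp only [Finset.mem_filter, Finset.mem_univ, true_and] at hl ⊢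
      exact rankedAbove_of_lt (hlt.trans_le hl)
    unfold position at h
    omega

lemma exists_top_three (hN : 3 ≤ N) (σ : Equiv.Perm (Fin N)) (b : Fin N → ℝ) :
    ∃ i j k, RankedAbove σ b i j ∧ RankedAbove σ b j k ∧
      ∀ l, l ≠ i → l ≠ j → l ≠ k → RankedAbove σ b k l := by
  have hc : (Finset.univ : Finset (Fin N)).card = N := by simp
  obtain ⟨i, -, hi⟩ := exists_top σ b (s := Finset.univ) (Finset.card_pos.1 (by omega))
  obtain ⟨j, hj, hj'⟩ := exists_top σ b (s := Finset.univ.erase i)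
    (Finset.card_pos.1 (by rw [Finset.card_erase_of_mem (Finset.mem_univ i)]; omega))
  obtain ⟨k, hk, hk'⟩ := exists_top σ b (s := (Finset.univ.erase i).erase j)
    (Finset.card_pos.1 (by
      rw [Finset.card_erase_of_mem hj, Finset.card_erase_of_mem (Finset.mem_univ i)]; omega))
  simp only [Finset.mem_erase, Finset.mem_univ, and_true] at hj hk
  refine ⟨i, j, k, hi j (Finset.mem_univ _) hj, hj' k (by simpa using hk.2) hk.1, ?_⟩
  intro l h1 h2 h3
  exact hk' l (by simp [h1, h2]) h3

/-- The ranking among the rivals of `i` is unaffected by his own bid, so deviations can be analysed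
with the same `j` and `k`. -/
lemma exists_top_two_rivals (hN : 3 ≤ N) (σ : Equiv.Perm (Fin N)) (b : Fin N → ℝ) (i : Fin N) :
    ∃ j k, j ≠ i ∧ k ≠ i ∧ RankedAbove σ b j k ∧
      ∀ l, l ≠ i → l ≠ j → l ≠ k → RankedAbove σ b k l := by
  have hc : (Finset.univ : Finset (Fin N)).card = N := by simp
  obtain ⟨j, hj, hj'⟩ := exists_top σ b (s := Finset.univ.erase i)
    (Finset.card_pos.1 (by rw [Finset.card_erase_of_mem (Finset.mem_univ i)]; omega))
  obtain ⟨k, hk, hk'⟩ := exists_top σ b (s := (Finset.univ.erase i).erase j)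
    (Finset.card_pos.1 (by
      rw [Finset.card_erase_of_mem hj, Finset.card_erase_of_mem (Finset.mem_univ i)]; omega))
  simp only [Finset.mem_erase, Finset.mem_univ, and_true] at hj hk
  refine ⟨j, k, hj, hk.2, hj' k (by simpa using hk.2) hk.1, ?_⟩
  intro l h1 h2 h3
  exact hk' l (by simp [h1, h2]) h3

/-- Order statistics do not depend on how ties are broken, so the identity order serves to locate
them. -/
lemma exists_kthHighest_eq (hN : 3 ≤ N) (b : Fin N → ℝ) {n : ℕ} (hn : n = 2 ∨ n = 3) :
    ∃ i, kthHighest b n = b i ∧ position 1 b i = n := by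
  obtain ⟨i, j, k, h1, h2, h3⟩ := exists_top_three hN 1 b
  rcases hn with rfl | rfl
  · have : position 1 b j = 2 := position_eq_two h1 fun l hi hj => by
      by_cases hk : l = k
      · exact hk ▸ h2
      · exact h2.trans (h3 l hi hj hk)
    exact ⟨j, kthHighest_eq_of_position this, this⟩
  · have := position_eq_three h1 h2 h3
    exact ⟨k, kthHighest_eq_of_position this, this⟩

/-- Reduces superlevel sets of order statistics to counts of coordinates, from which measurability
follows. -/
lemma le_kthHighest_iff (hN : 3 ≤ N) {n : ℕ} (hn : n = 2 ∨ n = 3) {c : ℝ} :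
    c ≤ kthHighest b n ↔ n ≤ (Finset.univ.filter fun j => c ≤ b j).card := by
  classical
  obtain ⟨i, hi, hp⟩ := exists_kthHighest_eq hN b hn
  rw [hi]
  have hmem : i ∉ Finset.univ.filter fun j => RankedAbove 1 b j i := by
    simpa using not_rankedAbove_self
  constructor
  · intro hc
    rw [← hp]
    unfold position
    rw [← Finset.card_insert_of_notMem hmem]
    refine Finset.card_le_card fun l hl => ?_
    simp only [Finset.mem_insert, Finset.mem_filter, Finset.mem_univ, true_and] at hl ⊢
    rcases hl with rfl | hl
    exacts [hc, hc.trans hl.le]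
  · intro hc
    by_contra! hlt
    have : (Finset.univ.filter fun j => c ≤ b j).card
        ≤ (Finset.univ.filter fun j => RankedAbove 1 b j i).card := by
      refine Finset.card_le_card fun l hl => ?_
      simp only [Finset.mem_filter, Finset.mem_univ, true_and] at hl ⊢
      exact rankedAbove_of_lt (hlt.trans_le hl)
    unfold position at hp
    omega

end Ranking

/-! ### The second auction -/

section SecondPeriod

variable {N : ℕ} {x : Fin N → ℝ} {i j : Fin N} {w : Option (Fin N)}

/-- The highest value among the rivals of buyer `i` in the second auction. -/
def rivalMax (x : Fin N → ℝ) (i : Fin N) (w : Option (Fin N)) : ℝ :=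
  ⨆ j : {j : Fin N // j ≠ i ∧ w ≠ some j}, x j

lemma secondPeriodPayoff_eq : secondPeriodPayoff x i w = max (x i - rivalMax x i w) 0 := rfl

lemma rivalMax_eq (hj : j ≠ i) (hw : w ≠ some j) (h : ∀ l, l ≠ i → w ≠ some l → x l ≤ x j) :
    rivalMax x i w = x j := by
  refine IsGreatest.csSup_eq ⟨⟨⟨j, hj, hw⟩, rfl⟩, ?_⟩
  rintro _ ⟨l, rfl⟩
  exact h l l.2.1 l.2.2

lemma rivalMax_update (v : ℝ) : rivalMax (Function.update x i v) i w = rivalMax x i w := by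
  unfold rivalMax
  congr 1
  ext j
  rw [Function.update_of_ne j.2.1]

lemma le_rivalMax {c : ℝ} (hN : 3 ≤ N) (h : ∀ j, c ≤ x j) : c ≤ rivalMax x i w := by
  have : ∃ j, j ≠ i ∧ w ≠ some j := by
    by_contra! hcon
    -- Without an eligible rival every buyer would be `i` or the holder of the first unit,
    -- contradicting `3 ≤ N`. For `w = none` the default `i` keeps the set well formed.
    have hs : (Finset.univ : Finset (Fin N)) ⊆ {i, w.getD i} := by
      intro j _
      by_cases hj : j = i
      · simp [hj]
      · simp [hcon j hj]
    have := (Finset.card_le_card hs).trans Finset.card_le_two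
    rw [Finset.card_univ, Fintype.card_fin] at this
    omega
  obtain ⟨j, hj⟩ := this
  exact (h j).trans (le_ciSup (f := fun j : {j : Fin N // j ≠ i ∧ w ≠ some j} => x j)
    (Set.finite_range _).bddAbove ⟨j, hj⟩)

lemma secondPeriodPayoff_nonneg : 0 ≤ secondPeriodPayoff x i w := le_max_right _ _

lemma secondPeriodPayoff_le (hN : 3 ≤ N) (h : ∀ j, 0 ≤ x j) :
    secondPeriodPayoff x i w ≤ x i := by
  rw [secondPeriodPayoff_eq]
  exact max_le (by linarith [le_rivalMax (i := i) (w := w) hN h]) (h i)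

lemma secondPeriodPayoff_eq_zero (hN : 3 ≤ N) (h : ∀ j, x i ≤ x j) :
    secondPeriodPayoff x i w = 0 := by
  rw [secondPeriodPayoff_eq]
  exact max_eq_right (by linarith [le_rivalMax (i := i) (w := w) hN h])

end SecondPeriod

/-! ### Thresholds -/

section Threshold

variable {ψ : ℝ → EReal} {lo hi x y : ℝ}

/-- The set whose minimum is `threshold ψ lo hi x`. -/
def thresholdSet (ψ : ℝ → EReal) (lo hi x : ℝ) : Set ℝ :=
  {a : ℝ | a ∈ Icc lo hi ∧ x ≤ a ∧ (x : EReal) ≤ (a : EReal) + ψ a}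

lemma threshold_eq : threshold ψ lo hi x = sInf (thresholdSet ψ lo hi x) := rfl

lemma bddBelow_thresholdSet : BddBelow (thresholdSet ψ lo hi x) := ⟨lo, fun _ h => h.1.1⟩

lemma threshold_mem_Icc (h : (thresholdSet ψ lo hi x).Nonempty) :
    threshold ψ lo hi x ∈ Icc lo hi := by
  refine ⟨le_csInf h fun a ha => ha.1.1, ?_⟩
  obtain ⟨a, ha⟩ := h
  exact (csInf_le bddBelow_thresholdSet ha).trans ha.1.2

lemma le_threshold (h : (thresholdSet ψ lo hi x).Nonempty) : x ≤ threshold ψ lo hi x :=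
  le_csInf h fun _ ha => ha.2.1

lemma threshold_le_of_mem (h : y ∈ thresholdSet ψ lo hi x) : threshold ψ lo hi x ≤ y :=
  csInf_le bddBelow_thresholdSet h

lemma threshold_eq_self (hx : x ∈ Icc lo hi) (h : 0 ≤ ψ x) : threshold ψ lo hi x = x := by
  have hmem : x ∈ thresholdSet ψ lo hi x := by
    refine ⟨hx, le_rfl, ?_⟩
    calc (x : EReal) = x + 0 := (add_zero _).symm
      _ ≤ x + ψ x := by gcongr
  exact le_antisymm (threshold_le_of_mem hmem) (le_threshold ⟨x, hmem⟩)

/-- The point `hi` always qualifies, so the infimum defining the threshold is never the junk value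
of an empty set for `x ≤ hi`. -/
lemma thresholdSet_nonempty (hψ : 0 ≤ ψ hi) (hx : x ≤ hi) (hlo : lo ≤ hi) :
    (thresholdSet ψ lo hi x).Nonempty := by
  refine ⟨hi, ⟨hlo, le_rfl⟩, hx, ?_⟩
  calc (x : EReal) ≤ hi := by exact_mod_cast hx
    _ = hi + 0 := (add_zero _).symm
    _ ≤ hi + ψ hi := by gcongr

end Threshold

/-! ### Ex post incentives -/

section ExPost

variable {N : ℕ} {ψ : ℝ → EReal} {lo hi : ℝ} {σ : Equiv.Perm (Fin N)} {b x : Fin N → ℝ}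
  {i j k w : Fin N}

lemma grossPayoff_zero : grossPayoff (0 : Fin N → ℝ) x i = secondPeriodPayoff x i none := by
  simp [grossPayoff]

lemma grossPayoff_single_self : grossPayoff (Pi.single i 1 : Fin N → ℝ) x i = x i := by
  have : ∑ j ∈ Finset.univ.erase i, (Pi.single i 1 : Fin N → ℝ) j * secondPeriodPayoff x i (some j)
      = 0 := Finset.sum_eq_zero fun j hj => by
    simp [(Finset.mem_erase.1 hj).1]
  simp [grossPayoff, this]

lemma grossPayoff_single_of_ne (h : w ≠ i) :
    grossPayoff (Pi.single w 1 : Fin N → ℝ) x i = secondPeriodPayoff x i (some w) := by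
  have : ∑ j ∈ Finset.univ.erase i, (Pi.single w 1 : Fin N → ℝ) j * secondPeriodPayoff x i (some j)
      = secondPeriodPayoff x i (some w) := by
    rw [Finset.sum_eq_single w]
    · simp
    · intro j _ hj; simp [hj]
    · simp [h]
  simp [grossPayoff, this, h.symm]

/-- The gross payoff is affine in the allocation probabilities. -/
lemma grossPayoff_mixture {ι : Type*} [Fintype ι] (τ : ι → ℝ) (hτ : ∑ s, τ s = 1)
    (P : ι → Fin N → ℝ) :
    grossPayoff (fun j => ∑ s, τ s * P s j) x i = ∑ s, τ s * grossPayoff (P s) x i := by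
  have h1 : ∑ j ∈ Finset.univ.erase i, (∑ s, τ s * P s j) * secondPeriodPayoff x i (some j)
      = ∑ s, τ s * ∑ j ∈ Finset.univ.erase i, P s j * secondPeriodPayoff x i (some j) := by
    simp_rw [Finset.sum_mul, Finset.mul_sum]
    rw [Finset.sum_comm]
    simp_rw [mul_assoc]
  have h2 : 1 - ∑ j, ∑ s, τ s * P s j = ∑ s, τ s * (1 - ∑ j, P s j) := by
    simp_rw [mul_sub, mul_one, Finset.mul_sum]
    rw [Finset.sum_sub_distrib, hτ, Finset.sum_comm]
  unfold grossPayoff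
  rw [h1, h2, Finset.sum_mul, Finset.sum_mul, ← Finset.sum_add_distrib, ← Finset.sum_add_distrib]
  refine Finset.sum_congr rfl fun s _ => ?_
  ring

/-- The modified third-price auction with a given priority order. -/
def priorityAuction (ψ : ℝ → EReal) (lo hi : ℝ) (σ : Equiv.Perm (Fin N)) : Mechanism N where
  alloc := thirdPriceAlloc ψ lo hi σ
  pay := thirdPricePay ψ lo hi σ

lemma payoff_modifiedThirdPriceAuction {τ : Equiv.Perm (Fin N) → ℝ} (hτ : ∑ σ, τ σ = 1) :
    payoff (modifiedThirdPriceAuction ψ lo hi τ) b x i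
      = ∑ σ, τ σ * payoff (priorityAuction ψ lo hi σ) b x i := by
  have := grossPayoff_mixture (x := x) (i := i) τ hτ fun σ => thirdPriceAlloc ψ lo hi σ b
  simp only [payoff, modifiedThirdPriceAuction, priorityAuction, mul_sub, Finset.sum_sub_distrib]
  rw [← this]

lemma thirdPriceAlloc_of_not_isAllocated (h : ¬ IsAllocated ψ lo hi b) :
    thirdPriceAlloc ψ lo hi σ b = 0 := by
  ext i; simp [thirdPriceAlloc, h]

lemma thirdPriceAlloc_of_isAllocated (h : IsAllocated ψ lo hi b) (hw : position σ b w = 2) :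
    thirdPriceAlloc ψ lo hi σ b = Pi.single w 1 := by
  ext i
  by_cases hi : i = w
  · subst hi; simp [thirdPriceAlloc, h, hw]
  · have : position σ b i ≠ 2 := fun hi' => hi (position_injective (hi'.trans hw.symm))
    simp [thirdPriceAlloc, this, hi]

lemma thirdPricePay_of_not_isAllocated (h : ¬ IsAllocated ψ lo hi b) :
    thirdPricePay ψ lo hi σ b i = 0 := by
  simp [thirdPricePay, h]

/-- When `ψ` is nonnegative at the third-highest bid, the threshold equals that bid. Both branches
of the payment rule then follow one formula, here and for the second-highest bidder. -/
lemma thirdPricePay_of_position_eq_one (h3 : kthHighest b 3 ∈ Icc lo hi)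
    (h : IsAllocated ψ lo hi b) (hp : position σ b i = 1) :
    thirdPricePay ψ lo hi σ b i = threshold ψ lo hi (kthHighest b 3) - kthHighest b 3 := by
  rw [thirdPricePay, if_pos h, if_pos hp]
  split_ifs with hneg
  · rfl
  · rw [threshold_eq_self h3 (not_lt.1 hneg), sub_self]

lemma thirdPricePay_of_position_eq_two (h3 : kthHighest b 3 ∈ Icc lo hi)
    (h : IsAllocated ψ lo hi b) (hp : position σ b i = 2) :
    thirdPricePay ψ lo hi σ b i = threshold ψ lo hi (kthHighest b 3) := by
  rw [thirdPricePay, if_pos h, if_neg (by omega), if_pos hp]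
  split_ifs with hneg
  · rfl
  · rw [threshold_eq_self h3 (not_lt.1 hneg)]

lemma thirdPricePay_of_position_ge_three (hp : 3 ≤ position σ b i) :
    thirdPricePay ψ lo hi σ b i = 0 := by
  rw [thirdPricePay, if_neg (by omega : ¬ position σ b i = 1),
    if_neg (by omega : ¬ position σ b i = 2), ite_self]

/-- The payoff of a bidder who is ranked first. -/
lemma payoff_of_top (hb : ∀ l, b l ∈ Icc lo hi) (hbx : ∀ l, l ≠ i → b l = x l)
    (hj : j ≠ i) (hk : k ≠ i) (hij : RankedAbove σ b i j)
    (hjk : RankedAbove σ b j k) (h : ∀ l, l ≠ i → l ≠ j → l ≠ k → RankedAbove σ b k l) :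
    payoff (priorityAuction ψ lo hi σ) b x i =
      if threshold ψ lo hi (x k) ≤ x j then
        max (x i - x k) 0 - (threshold ψ lo hi (x k) - x k)
      else max (x i - x j) 0 := by
  have hj' : ∀ l, l ≠ i → l ≠ j → RankedAbove σ b j l := fun l h1 h2 => by
    by_cases hl : l = k
    · exact hl ▸ hjk
    · exact hjk.trans (h l h1 h2 hl)
  have hi' : ∀ l, l ≠ i → RankedAbove σ b i l := fun l h1 => by
    by_cases hl : l = j
    · exact hl ▸ hij
    · exact hij.trans (hj' l h1 hl)
  have p1 := position_eq_one hi'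
  have p2 := position_eq_two hij hj'
  have p3 := position_eq_three hij hjk h
  have k2 := kthHighest_eq_of_position p2
  have k3 := kthHighest_eq_of_position p3
  have ha : IsAllocated ψ lo hi b ↔ threshold ψ lo hi (x k) ≤ x j := by
    rw [IsAllocated, k2, k3, hbx j hj, hbx k hk]
  unfold payoff
  split_ifs with hc
  · have hc' := ha.2 hc
    simp only [priorityAuction]
    rw [thirdPriceAlloc_of_isAllocated hc' p2, grossPayoff_single_of_ne hj,
      thirdPricePay_of_position_eq_one (k3 ▸ hb k) hc' p1, k3, hbx k hk, secondPeriodPayoff_eq,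
      rivalMax_eq (j := k) hk (by simpa using hjk.ne)]
    intro l hl hl'
    have hlj : l ≠ j := fun e => hl' (by rw [e])
    by_cases hlk : l = k
    · rw [hlk]
    · rw [← hbx l hl, ← hbx k hk]
      exact (h l hl hlj hlk).le
  · have hc' := mt ha.1 hc
    simp only [priorityAuction]
    rw [thirdPriceAlloc_of_not_isAllocated hc', grossPayoff_zero,
      thirdPricePay_of_not_isAllocated hc', sub_zero, secondPeriodPayoff_eq,
      rivalMax_eq (j := j) hj (by simp)]
    intro l hl _
    by_cases hlj : l = j
    · rw [hlj]
    · rw [← hbx l hl, ← hbx j hj]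
      exact (hj' l hl hlj).le

/-- The payoff of a bidder who is ranked second. -/
lemma payoff_of_second (hb : ∀ l, b l ∈ Icc lo hi) (hbx : ∀ l, l ≠ i → b l = x l)
    (hj : j ≠ i) (hk : k ≠ i) (hji : RankedAbove σ b j i)
    (hik : RankedAbove σ b i k) (h : ∀ l, l ≠ i → l ≠ j → l ≠ k → RankedAbove σ b k l) :
    payoff (priorityAuction ψ lo hi σ) b x i =
      if threshold ψ lo hi (x k) ≤ b i then x i - threshold ψ lo hi (x k)
      else max (x i - x j) 0 := by
  have hi' : ∀ l, l ≠ j → l ≠ i → RankedAbove σ b i l := fun l h1 h2 => by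
    by_cases hl : l = k
    · exact hl ▸ hik
    · exact hik.trans (h l h2 h1 hl)
  have p2 := position_eq_two hji hi'
  have p3 := position_eq_three hji hik fun l h1 h2 h3 => h l h2 h1 h3
  have k2 := kthHighest_eq_of_position p2
  have k3 := kthHighest_eq_of_position p3
  have ha : IsAllocated ψ lo hi b ↔ threshold ψ lo hi (x k) ≤ b i := by
    rw [IsAllocated, k2, k3, hbx k hk]
  unfold payoff
  split_ifs with hc
  · have hc' := ha.2 hc
    simp only [priorityAuction]
    rw [thirdPriceAlloc_of_isAllocated hc' p2, grossPayoff_single_self,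
      thirdPricePay_of_position_eq_two (k3 ▸ hb k) hc' p2, k3, hbx k hk]
  · have hc' := mt ha.1 hc
    simp only [priorityAuction]
    rw [thirdPriceAlloc_of_not_isAllocated hc', grossPayoff_zero,
      thirdPricePay_of_not_isAllocated hc', sub_zero, secondPeriodPayoff_eq,
      rivalMax_eq (j := j) hj (by simp)]
    intro l hl _
    by_cases hlj : l = j
    · rw [hlj]
    · rw [← hbx l hl, ← hbx j hj]
      exact (hji.trans (hi' l hlj hl)).le

/-- The payoff of a bidder who is ranked third or lower. -/
lemma payoff_of_low (hbx : ∀ l, l ≠ i → b l = x l)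
    (hj : j ≠ i) (hjk : RankedAbove σ b j k)
    (hki : RankedAbove σ b k i) (h : ∀ l, l ≠ i → l ≠ j → l ≠ k → RankedAbove σ b k l) :
    payoff (priorityAuction ψ lo hi σ) b x i = max (x i - x j) 0 := by
  have hk' : ∀ l, l ≠ j → l ≠ k → RankedAbove σ b k l := fun l h1 h2 => by
    by_cases hl : l = i
    · exact hl ▸ hki
    · exact h l hl h1 h2
  have hj' : ∀ l, l ≠ i → x l ≤ x j := fun l hl => by
    by_cases hlj : l = j
    · rw [hlj]
    · rw [← hbx l hl, ← hbx j hj]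
      by_cases hlk : l = k
      · exact hlk ▸ hjk.le
      · exact (hjk.trans (h l hl hlj hlk)).le
  have p2 := position_eq_two hjk hk'
  have pi : 3 ≤ position σ b i := by have := position_lt hki; omega
  unfold payoff
  simp only [priorityAuction]
  rw [thirdPricePay_of_position_ge_three pi, sub_zero]
  -- The unit goes to `k` or to nobody. In both cases `j` stays in the second auction as the
  -- strongest rival of `i`.
  by_cases hc : IsAllocated ψ lo hi b
  · rw [thirdPriceAlloc_of_isAllocated hc p2, grossPayoff_single_of_ne hki.ne,
      secondPeriodPayoff_eq, rivalMax_eq (j := j) hj (by simpa using hjk.ne.symm)]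
    exact fun l hl _ => hj' l hl
  · rw [thirdPriceAlloc_of_not_isAllocated hc, grossPayoff_zero,
      secondPeriodPayoff_eq, rivalMax_eq (j := j) hj (by simp)]
    exact fun l hl _ => hj' l hl

/-- The payoff from a bid is at most `max (xᵢ - min (a y₂) y₁) 0`, where `y₁`, `y₂` are the highest
values of the rivals, and truthful bidding yields this payoff. -/
lemma payoff_priorityAuction_le (hψ : 0 ≤ ψ hi) (hlo : lo ≤ hi) (hx : ∀ l, x l ∈ Icc lo hi)
    {q : ℝ} (hq : q ∈ Icc lo hi) (hj : j ≠ i) (hk : k ≠ i) (hjk : RankedAbove σ x j k)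
    (h : ∀ l, l ≠ i → l ≠ j → l ≠ k → RankedAbove σ x k l) :
    payoff (priorityAuction ψ lo hi σ) (Function.update x i q) x i
      ≤ max (x i - min (threshold ψ lo hi (x k)) (x j)) 0 ∧
    payoff (priorityAuction ψ lo hi σ) x x i
      = max (x i - min (threshold ψ lo hi (x k)) (x j)) 0 := by
  have hak : x k ≤ threshold ψ lo hi (x k) :=
    le_threshold (thresholdSet_nonempty hψ (hx k).2 hlo)
  have hxjk : x k ≤ x j := hjk.le
  set a := threshold ψ lo hi (x k) with ha
  constructor
  · set b := Function.update x i q with hbdef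
    have hbx : ∀ l, l ≠ i → b l = x l := fun l hl => Function.update_of_ne hl _ _
    have hbi : b i = q := Function.update_self _ _ _
    have hb : ∀ l, b l ∈ Icc lo hi := fun l => by
      by_cases hl : l = i
      · rw [hl, hbi]; exact hq
      · rw [hbx l hl]; exact hx l
    have hjk' : RankedAbove σ b j k := (rankedAbove_congr (hbx j hj) (hbx k hk)).2 hjk
    have h' : ∀ l, l ≠ i → l ≠ j → l ≠ k → RankedAbove σ b k l := fun l h1 h2 h3 =>
      (rankedAbove_congr (hbx k hk) (hbx l h1)).2 (h l h1 h2 h3)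
    rcases rankedAbove_or (σ := σ) (b := b) hj with hji | hij
    · rcases rankedAbove_or (σ := σ) (b := b) hk with hki | hik
      · rw [payoff_of_low hbx hj hjk' hki h']
        gcongr
        exact min_le_right _ _
      · rw [payoff_of_second hb hbx hj hk hji hik h', ← ha]
        split_ifs with hc
        · exact le_max_of_le_left (by gcongr; exact min_le_left _ _)
        · gcongr
          exact min_le_right _ _
    · rw [payoff_of_top hb hbx hj hk hij hjk' h', ← ha]
      split_ifs with hc
      -- The left side is the maximum of `x i - a` and `-(a - x k)`, and the latter is at most `0`.
      · rw [min_eq_left hc, ← max_sub_sub_right]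
        exact max_le_max (by linarith) (by linarith)
      · gcongr
        exact min_le_right _ _
  · rcases rankedAbove_or (σ := σ) (b := x) hj with hji | hij
    · have hxi := hji.le
      rcases rankedAbove_or (σ := σ) (b := x) hk with hki | hik
      · rw [payoff_of_low (fun _ _ => rfl) hj hjk hki h, max_eq_right (by linarith),
          max_eq_right]
        linarith [le_min hak hxjk, hki.le]
      · rw [payoff_of_second hx (fun _ _ => rfl) hj hk hji hik h, ← ha]
        split_ifs with hc
        · rw [min_eq_left (hc.trans hxi), max_eq_left (by linarith)]
        · rw [max_eq_right (by linarith), max_eq_right]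
          linarith [le_min (not_le.1 hc).le hxi]
    · have hxi := hij.le
      rw [payoff_of_top hx (fun _ _ => rfl) hj hk hij hjk h, ← ha]
      split_ifs with hc
      · rw [min_eq_left hc, max_eq_left (by linarith), max_eq_left (by linarith)]
        ring
      · rw [min_eq_right (not_le.1 hc).le]

lemma payoff_priorityAuction_deviation (hN : 3 ≤ N) (hψ : 0 ≤ ψ hi) (hlo : lo ≤ hi)
    (hx : ∀ l, x l ∈ Icc lo hi) {q : ℝ} (hq : q ∈ Icc lo hi) :
    payoff (priorityAuction ψ lo hi σ) (Function.update x i q) x i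
      ≤ payoff (priorityAuction ψ lo hi σ) x x i := by
  obtain ⟨j, k, hj, hk, hjk, h⟩ := exists_top_two_rivals hN σ x i
  obtain ⟨h1, h2⟩ := payoff_priorityAuction_le hψ hlo hx hq hj hk hjk h
  exact h2 ▸ h1

/-- Individual rationality even holds ex post: the effective price `min (a y₂) y₁` is at most the
price `y₁` faced when the first unit is withheld. -/
lemma secondPeriodPayoff_none_le_payoff_priorityAuction (hN : 3 ≤ N) (hψ : 0 ≤ ψ hi)
    (hlo : lo ≤ hi) (hx : ∀ l, x l ∈ Icc lo hi) :
    secondPeriodPayoff x i none ≤ payoff (priorityAuction ψ lo hi σ) x x i := by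
  obtain ⟨j, k, hj, hk, hjk, h⟩ := exists_top_two_rivals hN σ x i
  rw [(payoff_priorityAuction_le hψ hlo hx (hx i) hj hk hjk h).2, secondPeriodPayoff_eq,
    rivalMax_eq (j := j) hj (by simp)]
  · gcongr
    exact min_le_right _ _
  · intro l hl _
    by_cases hlj : l = j
    · rw [hlj]
    · by_cases hlk : l = k
      · exact hlk ▸ hjk.le
      · exact (hjk.trans (h l hl hlj hlk)).le

/-- The effective price is never below `lo`. This makes individual rationality bind for the lowest
type. -/
lemma payoff_priorityAuction_eq_zero (hN : 3 ≤ N) (hψ : 0 ≤ ψ hi)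
    (hlo : lo ≤ hi) (hx : ∀ l, x l ∈ Icc lo hi) (hi0 : x i = lo) :
    payoff (priorityAuction ψ lo hi σ) x x i = 0 := by
  obtain ⟨j, k, hj, hk, hjk, h⟩ := exists_top_two_rivals hN σ x i
  rw [(payoff_priorityAuction_le hψ hlo hx (hx i) hj hk hjk h).2, max_eq_right]
  have := le_min (threshold_mem_Icc (thresholdSet_nonempty hψ (hx k).2 hlo)).1 (hx j).1
  linarith

variable {τ : Equiv.Perm (Fin N) → ℝ}

theorem isExPostEquilibrium_modifiedThirdPriceAuction (hN : 3 ≤ N) (hψ : 0 ≤ ψ hi) (hlo : lo ≤ hi)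
    (hτ : τ ∈ stdSimplex ℝ (Equiv.Perm (Fin N))) :
    IsExPostEquilibrium lo hi (modifiedThirdPriceAuction ψ lo hi τ) (truthful N) := by
  intro x hx i q hq
  simp only [truthful]
  rw [payoff_modifiedThirdPriceAuction hτ.2, payoff_modifiedThirdPriceAuction hτ.2]
  exact Finset.sum_le_sum fun σ _ => mul_le_mul_of_nonneg_left
    (payoff_priorityAuction_deviation hN hψ hlo hx hq) (hτ.1 σ)

lemma secondPeriodPayoff_none_le_payoff (hN : 3 ≤ N) (hψ : 0 ≤ ψ hi) (hlo : lo ≤ hi)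
    (hτ : τ ∈ stdSimplex ℝ (Equiv.Perm (Fin N))) (hx : ∀ l, x l ∈ Icc lo hi) :
    secondPeriodPayoff x i none ≤ payoff (modifiedThirdPriceAuction ψ lo hi τ) x x i := by
  rw [payoff_modifiedThirdPriceAuction hτ.2]
  calc secondPeriodPayoff x i none = ∑ σ, τ σ * secondPeriodPayoff x i none := by
        rw [← Finset.sum_mul, hτ.2, one_mul]
    _ ≤ _ := Finset.sum_le_sum fun σ _ => mul_le_mul_of_nonneg_left
      (secondPeriodPayoff_none_le_payoff_priorityAuction hN hψ hlo hx) (hτ.1 σ)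

lemma payoff_modifiedThirdPriceAuction_eq_zero (hN : 3 ≤ N) (hψ : 0 ≤ ψ hi) (hlo : lo ≤ hi)
    (hτ : ∑ σ, τ σ = 1) (hx : ∀ l, x l ∈ Icc lo hi) (hi0 : x i = lo) :
    payoff (modifiedThirdPriceAuction ψ lo hi τ) x x i = 0 := by
  rw [payoff_modifiedThirdPriceAuction hτ]
  exact Finset.sum_eq_zero fun σ _ => by
    rw [payoff_priorityAuction_eq_zero hN hψ hlo hx hi0, mul_zero]

end ExPost

/-! ### Resampling one coordinate -/

section Resample

variable {N : ℕ} (μ : Measure ℝ) [IsProbabilityMeasure μ]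

lemma measurable_update_prod (i : Fin N) :
    Measurable fun p : (Fin N → ℝ) × ℝ => Function.update p.1 i p.2 :=
  measurable_update'

/-- Redrawing one coordinate independently does not change a product law. This links ex ante
integrals to interim ones, where the own value is overwritten. -/
lemma measurePreserving_update (i : Fin N) :
    MeasurePreserving (fun p : (Fin N → ℝ) × ℝ => Function.update p.1 i p.2)
      ((Measure.pi fun _ => μ).prod μ) (Measure.pi fun _ => μ) := by
  refine ⟨measurable_update_prod i, (Measure.pi_eq fun s hs => ?_).symm⟩
  rw [Measure.map_apply (measurable_update_prod i) (MeasurableSet.univ_pi hs)]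
  have : (fun p : (Fin N → ℝ) × ℝ => Function.update p.1 i p.2) ⁻¹' (univ.pi s)
      = (univ.pi (Function.update s i univ)) ×ˢ s i := by
    ext ⟨x, q⟩
    simp only [mem_preimage, mem_pi, mem_univ, true_implies, mem_prod]
    constructor
    · intro h
      refine ⟨fun j => ?_, by simpa using h i⟩
      by_cases hj : j = i
      · subst hj; simp
      · have := h j
        rw [Function.update_of_ne hj] at this ⊢
        exact this
    · rintro ⟨h, hq⟩ j
      by_cases hj : j = i
      · subst hj; simpa using hq
      · have := h j
        rw [Function.update_of_ne hj] at this ⊢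
        exact this
  rw [this, Measure.prod_prod, Measure.pi_pi, ← Finset.prod_erase_mul _ _ (Finset.mem_univ i),
    ← Finset.prod_erase_mul Finset.univ (fun j => μ (s j)) (Finset.mem_univ i)]
  simp only [Function.update_self, measure_univ, mul_one]
  congr 1
  refine Finset.prod_congr rfl fun j hj => ?_
  rw [Function.update_of_ne (Finset.ne_of_mem_erase hj)]

variable {μ}

lemma integrable_resample {g : (Fin N → ℝ) → ℝ} (i : Fin N)
    (hg : Integrable g (Measure.pi fun _ => μ)) :
    Integrable (fun q => ∫ x, g (Function.update x i q) ∂(Measure.pi fun _ => μ)) μ :=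
  ((measurePreserving_update μ i).integrable_comp_of_integrable hg).integral_prod_right

lemma integral_resample {g : (Fin N → ℝ) → ℝ} (i : Fin N)
    (hg : Integrable g (Measure.pi fun _ => μ)) :
    ∫ x, g x ∂(Measure.pi fun _ => μ)
      = ∫ q, ∫ x, g (Function.update x i q) ∂(Measure.pi fun _ => μ) ∂μ := by
  have hmp := measurePreserving_update μ i
  have hint : Integrable (fun p : (Fin N → ℝ) × ℝ => g (Function.update p.1 i p.2))
      ((Measure.pi fun _ => μ).prod μ) := hmp.integrable_comp_of_integrable hg
  rw [← integral_prod_symm _ hint]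
  have hg' := hg.aestronglyMeasurable
  rw [← hmp.map_eq] at hg'
  conv_lhs => rw [← hmp.map_eq]
  exact integral_map hmp.measurable.aemeasurable hg'

/-- With the other coordinates fixed, the exceptional values of `x i` form a single point. It is
applied to the identity (no ties) and to the threshold function. -/
lemma ae_ne_of_measurable [NullSingletonClass μ] {g : ℝ → ℝ} (hg : Measurable g) {i j : Fin N}
    (hij : i ≠ j) : ∀ᵐ x ∂(Measure.pi fun _ : Fin N => μ), x i ≠ g (x j) := by
  have hmp := measurePreserving_update μ i
  have hmeas : MeasurableSet {x : Fin N → ℝ | x i = g (x j)} :=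
    measurableSet_eq_fun (measurable_pi_apply i) (hg.comp (measurable_pi_apply j))
  have h0 : Measure.pi (fun _ : Fin N => μ) {x : Fin N → ℝ | x i = g (x j)} = 0 := by
    rw [← hmp.measure_preimage hmeas.nullMeasurableSet,
      Measure.measure_prod_null (hmp.measurable hmeas)]
    refine Filter.Eventually.of_forall fun x => ?_
    have : Prod.mk x ⁻¹' ((fun p : (Fin N → ℝ) × ℝ => Function.update p.1 i p.2) ⁻¹'
        {x : Fin N → ℝ | x i = g (x j)}) = {g (x j)} := by
      ext q
      simp [Function.update_of_ne hij.symm]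
    simp only [Pi.zero_apply]
    rw [this, measure_singleton]
  rw [ae_iff]
  simpa using h0

lemma ae_pi_mem {s : Set ℝ} (hs : ∀ᵐ v ∂μ, v ∈ s) :
    ∀ᵐ x ∂(Measure.pi fun _ : Fin N => μ), ∀ j, x j ∈ s := by
  rw [ae_all_iff]
  intro j
  exact (Measure.quasiMeasurePreserving_eval (fun _ : Fin N => μ) j).ae hs

end Resample

/-! ### The envelope formula -/

section Envelope

variable {U D : ℝ → ℝ} {lo hi : ℝ}

/-- A subgradient selection is monotone, hence discontinuous only at countably many points, and `U`
is 1-Lipschitz since `0 ≤ D ≤ 1`. Where `D` is continuous, `U` has derivative `D`, so the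
fundamental theorem with a countable exceptional set applies. -/
lemma integral_eq_sub_of_subgradient (hU : ∀ s ∈ Icc lo hi, ∀ t ∈ Icc lo hi,
      U s + D s * (t - s) ≤ U t)
    (hD : ∀ s ∈ Icc lo hi, 0 ≤ D s ∧ D s ≤ 1) {v : ℝ} (hv : v ∈ Icc lo hi) :
    ∫ s in lo..v, D s = U v - U lo := by
  have hmono : MonotoneOn D (Icc lo hi) := by
    intro s hs t ht hst
    rcases hst.eq_or_lt with rfl | hlt
    · exact le_rfl
    · have h1 := hU s hs t ht
      have h2 := hU t ht s hs
      have : (D t - D s) * (t - s) ≥ 0 := by nlinarith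
      by_contra! hcon
      nlinarith
  have hsub : Icc lo v ⊆ Icc lo hi := Icc_subset_Icc_right hv.2
  have hlip : ∀ s ∈ Icc lo hi, ∀ t ∈ Icc lo hi, |U t - U s| ≤ |t - s| := by
    have key : ∀ s ∈ Icc lo hi, ∀ t ∈ Icc lo hi, s ≤ t → |U t - U s| ≤ |t - s| := by
      intro s hs t ht hst
      rw [abs_of_nonneg (sub_nonneg.2 hst), abs_le]
      have h1 := hU s hs t ht
      have h2 := hU t ht s hs
      have := hD s hs
      have := hD t ht
      constructor <;> nlinarith
    intro s hs t ht
    rcases le_total s t with h | h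
    · exact key s hs t ht h
    · rw [abs_sub_comm (U t), abs_sub_comm t]; exact key t ht s hs h
  have hcont : ContinuousOn U (Icc lo hi) := by
    refine (LipschitzOnWith.of_dist_le_mul (K := 1) fun s hs t ht => ?_).continuousOn
    rw [Real.dist_eq, Real.dist_eq, NNReal.coe_one, one_mul]
    exact hlip t ht s hs
  refine integral_eq_of_hasDerivAt_off_countable_of_le U D hv.1
    hmono.countable_not_continuousWithinAt (hcont.mono hsub) ?_ ?_
  · rintro s ⟨hs, hsc⟩
    have hs' : s ∈ Icc lo hi := hsub (Ioo_subset_Icc_self hs)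
    have hnhds : Icc lo hi ∈ nhds s := Icc_mem_nhds hs.1 (hs.2.trans_le hv.2)
    have hcts : ContinuousAt D s := by
      have : ContinuousWithinAt D (Icc lo hi) s := by
        by_contra hcon
        exact hsc ⟨hs', hcon⟩
      exact this.continuousAt hnhds
    rw [hasDerivAt_iff_isLittleO, Asymptotics.isLittleO_iff]
    intro c hc
    have hev : ∀ᶠ t in nhds s, |D t - D s| < c := by
      have := Metric.continuousAt_iff.1 hcts c hc
      obtain ⟨δ, hδ, h⟩ := this
      filter_upwards [Metric.ball_mem_nhds s hδ] with t ht using h ht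
    filter_upwards [hev, hnhds] with t ht hti
    have h1 := hU s hs' t hti
    have h2 := hU t hti s hs'
    rw [smul_eq_mul, Real.norm_eq_abs, Real.norm_eq_abs]
    -- The subgradient inequalities at `s` and at `t` squeeze the remainder between `0` and `(D t -
    -- D s) * (t - s)`.
    have h3 : 0 ≤ U t - U s - (t - s) * D s := by linarith
    have h4 : U t - U s - (t - s) * D s ≤ (D t - D s) * (t - s) := by linarith
    rw [abs_of_nonneg h3]
    calc _ ≤ (D t - D s) * (t - s) := h4
      _ ≤ |(D t - D s) * (t - s)| := le_abs_self _
      _ = |D t - D s| * |t - s| := abs_mul _ _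
      _ ≤ c * |t - s| := by gcongr
  · refine MonotoneOn.intervalIntegrable ?_
    rw [uIcc_of_le hv.1]
    exact hmono.mono hsub

end Envelope

/-! ### The distribution of values -/

section Distribution

variable {μ : Measure ℝ} {f : ℝ → ℝ} {lo hi : ℝ}

/-- The inverse hazard rate `(1 - F) / f`. -/
def invHazard (μ : Measure ℝ) (f : ℝ → ℝ) (x : ℝ) : ℝ := (1 - cdf μ x) / f x

namespace IsValueDistribution

lemma ae_mem_Icc (h : IsValueDistribution μ f lo hi) : ∀ᵐ v ∂μ, v ∈ Icc lo hi := by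
  have := Measure.support_mem_ae (μ := μ)
  rwa [h.support_eq] at this

lemma nullSingletonClass (h : IsValueDistribution μ f lo hi) : NullSingletonClass μ := by
  rw [h.eq_withDensity]
  infer_instance

lemma ae_mem_Ioo (h : IsValueDistribution μ f lo hi) : ∀ᵐ v ∂μ, v ∈ Ioo lo hi := by
  have := h.nullSingletonClass
  filter_upwards [h.ae_mem_Icc, Measure.ae_ne μ lo, Measure.ae_ne μ hi] with v h1 h2 h3
  exact ⟨lt_of_le_of_ne h1.1 h2.symm, lt_of_le_of_ne h1.2 h3⟩

lemma lo_lt_hi (h : IsValueDistribution μ f lo hi) : lo < hi := by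
  have := h.isProbabilityMeasure
  obtain ⟨v, hv⟩ := h.ae_mem_Ioo.exists
  exact hv.1.trans hv.2

lemma measurable_density (h : IsValueDistribution μ f lo hi) : Measurable f := by
  classical
  have hf : f = (Icc lo hi).piecewise f (fun _ => 0) := by
    ext x
    by_cases hx : x ∈ Icc lo hi
    · rw [piecewise_eq_of_mem _ _ _ hx]
    · rw [piecewise_eq_of_notMem _ _ _ hx, h.density_eq_zero x hx]
  rw [hf]
  exact h.density_continuousOn.measurable_piecewise continuousOn_const measurableSet_Icc

lemma cdf_lt_one (h : IsValueDistribution μ f lo hi) {x : ℝ} (hx : x < hi) : cdf μ x < 1 := by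
  have := h.isProbabilityMeasure
  have hmem : hi ∈ μ.support := h.support_eq ▸ ⟨h.lo_lt_hi.le, le_rfl⟩
  have hpos : 0 < μ (Ioi x) := (Measure.mem_support_iff_forall hi).1 hmem _ (Ioi_mem_nhds hx)
  have h1 : μ.real (Ioi x) = 1 - μ.real (Iic x) := by
    rw [← compl_Iic, measureReal_compl measurableSet_Iic, probReal_univ]
  have h2 : 0 < μ.real (Ioi x) := ENNReal.toReal_pos hpos.ne' (measure_ne_top _ _)
  rw [cdf_eq_real]
  linarith

lemma virtualValue_eq_bot (h : IsValueDistribution μ f lo hi) {x : ℝ} (hx : x < hi)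
    (hf : f x = 0) : virtualValue μ f x = ⊥ := by
  have h1 : ENNReal.ofReal (1 - cdf μ x) ≠ 0 := by
    have := h.cdf_lt_one hx
    simpa using this
  simp [virtualValue, hf, ENNReal.div_zero h1]

lemma virtualValue_eq {x : ℝ} (hf : 0 < f x) :
    virtualValue μ f x = ((x - invHazard μ f x : ℝ) : EReal) := by
  have h1 : 0 ≤ (1 - cdf μ x) / f x :=
    div_nonneg (by linarith [cdf_le_one μ x]) hf.le
  rw [virtualValue, ← ENNReal.ofReal_div_of_pos hf, EReal.coe_ennreal_ofReal, max_eq_left h1,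
    invHazard, EReal.coe_sub]

lemma virtualValue_hi (h : IsValueDistribution μ f lo hi) : virtualValue μ f hi = hi := by
  have := h.isProbabilityMeasure
  have h1 : cdf μ hi = 1 := by
    rw [cdf_eq_real]
    have : μ (Iic hi) = 1 := by
      rw [← mem_ae_iff_prob_eq_one measurableSet_Iic]
      filter_upwards [h.ae_mem_Icc] with v hv using hv.2
    simp [Measure.real, this]
  simp [virtualValue, h1]

/-- A zero of `f` below `hi` gives `ψ = -∞` there, and monotonicity carries this to every smaller
value. The density would then vanish near `lo`, which lies in the support. -/
lemma density_pos (h : IsValueDistribution μ f lo hi)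
    (hψ : MonotoneOn (virtualValue μ f) (Icc lo hi)) {x : ℝ} (hx : x ∈ Ioo lo hi) : 0 < f x := by
  by_contra hcon
  have hfx : f x = 0 := le_antisymm (not_lt.1 hcon) (h.density_nonneg x)
  have hzero : ∀ y ≤ x, f y = 0 := by
    intro y hy
    by_contra hfy
    have hpos : 0 < f y := lt_of_le_of_ne (h.density_nonneg y) (Ne.symm hfy)
    have hmem : y ∈ Icc lo hi := by
      by_contra hn
      exact hfy (h.density_eq_zero y hn)
    have hle := hψ hmem (Ioo_subset_Icc_self hx) hy
    rw [h.virtualValue_eq_bot hx.2 hfx, virtualValue_eq hpos] at hle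
    exact EReal.coe_ne_bot _ (le_bot_iff.1 hle)
  have hmem : lo ∈ μ.support := h.support_eq ▸ ⟨le_rfl, h.lo_lt_hi.le⟩
  have hpos : 0 < μ (Iio x) := (Measure.mem_support_iff_forall lo).1 hmem _ (Iio_mem_nhds hx.1)
  rw [h.eq_withDensity, withDensity_apply _ measurableSet_Iio,
    setLIntegral_congr_fun (g := fun _ => 0) measurableSet_Iio
      (fun y hy => by simp [hzero y (le_of_lt hy)])] at hpos
  simp at hpos

lemma measurable_invHazard (h : IsValueDistribution μ f lo hi) : Measurable (invHazard μ f) :=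
  (measurable_const.sub (monotone_cdf μ).measurable).div h.measurable_density

lemma integral_eq (h : IsValueDistribution μ f lo hi) (g : ℝ → ℝ) :
    ∫ v, g v ∂μ = ∫ v in Ioo lo hi, g v * f v := by
  rw [← integral_Icc_eq_integral_Ioo, setIntegral_eq_integral_of_forall_compl_eq_zero
    fun x hx => by rw [h.density_eq_zero x hx, mul_zero], h.eq_withDensity,
    integral_withDensity_eq_integral_toReal_smul h.measurable_density.ennreal_ofReal
      (Filter.Eventually.of_forall fun x => ENNReal.ofReal_lt_top)]
  refine integral_congr_ae (Filter.Eventually.of_forall fun x => ?_)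
  simp only [smul_eq_mul]
  rw [ENNReal.toReal_ofReal (h.density_nonneg x), mul_comm]

/-- The inverse hazard rate may be unbounded, but multiplied by `f` it is `1 - F` or, at zeros of
`f`, `0`. -/
lemma integrable_invHazard (h : IsValueDistribution μ f lo hi) : Integrable (invHazard μ f) μ := by
  rw [h.eq_withDensity, integrable_withDensity_iff_integrable_smul'
    h.measurable_density.ennreal_ofReal
    (Filter.Eventually.of_forall fun x => ENNReal.ofReal_lt_top), ← h.eq_withDensity]
  have hb : Integrable ((Icc lo hi).indicator fun _ : ℝ => (1 : ℝ)) :=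
    IntegrableOn.integrable_indicator (integrable_const (1 : ℝ)) measurableSet_Icc
  refine hb.mono' ?_ (Filter.Eventually.of_forall fun x => ?_)
  · exact (h.measurable_density.ennreal_ofReal.ennreal_toReal.smul
      h.measurable_invHazard).aestronglyMeasurable
  · rw [ENNReal.toReal_ofReal (h.density_nonneg x), smul_eq_mul, invHazard]
    by_cases hx : f x = 0
    · rw [hx]
      simp [indicator_nonneg]
    · have hmem : x ∈ Icc lo hi := by
        by_contra hn
        exact hx (h.density_eq_zero x hn)
      rw [mul_div_cancel₀ _ hx, indicator_of_mem hmem, Real.norm_eq_abs, abs_le]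
      constructor <;> linarith [cdf_nonneg μ x, cdf_le_one μ x]

/-- Integration by parts against the distribution of values. -/
lemma integral_integral_eq (h : IsValueDistribution μ f lo hi)
    (hψ : MonotoneOn (virtualValue μ f) (Icc lo hi)) {D : ℝ → ℝ} (hDm : Measurable D)
    (hD : ∀ s ∈ Icc lo hi, 0 ≤ D s ∧ D s ≤ 1) :
    ∫ v, (∫ s in lo..v, D s) ∂μ = ∫ s, D s * invHazard μ f s ∂μ := by
  have := h.isProbabilityMeasure
  have hstep : ∀ᵐ v ∂μ, ∫ s in lo..v, D s
      = ∫ s in Ioo lo hi, (Iio v).indicator D s := by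
    filter_upwards [h.ae_mem_Icc] with v hv
    rw [intervalIntegral.integral_of_le hv.1, integral_Ioc_eq_integral_Ioo,
      setIntegral_indicator measurableSet_Iio]
    congr 2
    ext s
    simp only [mem_Ioo, mem_inter_iff, mem_Iio]
    constructor
    · rintro ⟨a, b⟩; exact ⟨⟨a, b.trans_le hv.2⟩, b⟩
    · rintro ⟨⟨a, -⟩, b⟩; exact ⟨a, b⟩
  -- By Fubini, `D s` is weighted by the mass `1 - F s` of values above `s`. Positivity of `f`
  -- allows writing this mass as the inverse hazard rate times the density.
  rw [integral_congr_ae hstep, integral_integral_swap, h.integral_eq]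
  · refine setIntegral_congr_fun measurableSet_Ioo fun s hs => ?_
    have h1 : ∀ v : ℝ, (Iio v).indicator D s = (Ioi s).indicator (fun _ => D s) v := by
      intro v
      by_cases hsv : s < v <;> simp [hsv]
    simp only [h1]
    rw [integral_indicator_const _ measurableSet_Ioi, smul_eq_mul, mul_assoc, invHazard,
      div_mul_cancel₀ _ (h.density_pos hψ hs).ne', ← compl_Iic,
      measureReal_compl measurableSet_Iic, probReal_univ, cdf_eq_real, mul_comm]
  · have hmeas : Measurable (Function.uncurry fun v s : ℝ => (Iio v).indicator D s) := by
      have : (Function.uncurry fun v s : ℝ => (Iio v).indicator D s)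
          = {p : ℝ × ℝ | p.2 < p.1}.indicator fun p => D p.2 := by
        ext ⟨v, s⟩
        simp [indicator]
      rw [this]
      exact (hDm.comp measurable_snd).indicator (measurableSet_lt measurable_snd measurable_fst)
    refine Integrable.of_bound hmeas.aestronglyMeasurable 1 ?_
    have hae : ∀ᵐ p ∂(μ.prod (volume.restrict (Ioo lo hi))), p.2 ∈ Ioo lo hi :=
      Measure.quasiMeasurePreserving_snd.ae (ae_restrict_mem measurableSet_Ioo)
    filter_upwards [hae] with p hp
    have := hD p.2 (Ioo_subset_Icc_self hp)
    simp only [Function.uncurry, indicator]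
    split_ifs
    · rw [Real.norm_eq_abs, abs_of_nonneg this.1]; exact this.2
    · simp

end IsValueDistribution

end Distribution

/-! ### Gross payoffs as functions of the own value -/

section Mix

variable {N : ℕ} {p : Fin N → ℝ} {x : Fin N → ℝ} {i : Fin N}

/-- The expectation of a quantity that is `a` if `i` gets the unit, `A j` if another buyer `j` gets
it, and `A₀` if it is withheld. -/
def mix (p : Fin N → ℝ) (i : Fin N) (a : ℝ) (A : Fin N → ℝ) (A₀ : ℝ) : ℝ :=
  p i * a + ∑ j ∈ Finset.univ.erase i, p j * A j + (1 - ∑ j, p j) * A₀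

lemma mix_mono (hp : ∀ j, 0 ≤ p j) (hs : ∑ j, p j ≤ 1) {a b A₀ B₀ : ℝ} {A B : Fin N → ℝ}
    (h : a ≤ b) (hA : ∀ j, A j ≤ B j) (h₀ : A₀ ≤ B₀) : mix p i a A A₀ ≤ mix p i b B B₀ := by
  unfold mix
  have := Finset.sum_le_sum (s := Finset.univ.erase i) fun j _ =>
    mul_le_mul_of_nonneg_left (hA j) (hp j)
  have := mul_le_mul_of_nonneg_left h (hp i)
  have := mul_le_mul_of_nonneg_left h₀ (sub_nonneg.2 hs)
  linarith

lemma mix_const (c : ℝ) : mix p i c (fun _ => c) c = c := by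
  unfold mix
  rw [← Finset.sum_mul, ← Finset.add_sum_erase _ p (Finset.mem_univ i)]
  ring

lemma mix_add_mul (c : ℝ) {a b A₀ B₀ : ℝ} {A B : Fin N → ℝ} :
    mix p i (a + b * c) (fun j => A j + B j * c) (A₀ + B₀ * c)
      = mix p i a A A₀ + mix p i b B B₀ * c := by
  unfold mix
  have : ∑ j ∈ Finset.univ.erase i, p j * (A j + B j * c)
      = ∑ j ∈ Finset.univ.erase i, p j * A j + (∑ j ∈ Finset.univ.erase i, p j * B j) * c := by
    rw [Finset.sum_mul, ← Finset.sum_add_distrib]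
    exact Finset.sum_congr rfl fun j _ => by ring
  rw [this]
  ring

lemma grossPayoff_eq_mix : grossPayoff p x i = mix p i (x i)
    (fun j => secondPeriodPayoff x i (some j)) (secondPeriodPayoff x i none) := rfl

open Classical in
/-- The indicator that buyer `i` wins the second auction if `w` got the first unit. -/
def winsSecond (x : Fin N → ℝ) (i : Fin N) (w : Option (Fin N)) : ℝ :=
  if rivalMax x i w < x i then 1 else 0

/-- The derivative of the gross payoff with respect to the own value: the probability to obtain one
of the units. -/
def winProb (p : Fin N → ℝ) (x : Fin N → ℝ) (i : Fin N) : ℝ :=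
  mix p i 1 (fun j => winsSecond x i (some j)) (winsSecond x i none)

lemma winsSecond_nonneg {w : Option (Fin N)} : 0 ≤ winsSecond x i w := by
  unfold winsSecond; split_ifs <;> norm_num

lemma winsSecond_le_one {w : Option (Fin N)} : winsSecond x i w ≤ 1 := by
  unfold winsSecond; split_ifs <;> norm_num

lemma winProb_nonneg (hp : ∀ j, 0 ≤ p j) (hs : ∑ j, p j ≤ 1) : 0 ≤ winProb p x i := by
  rw [← mix_const (p := p) (i := i) 0]
  exact mix_mono hp hs zero_le_one (fun j => winsSecond_nonneg) winsSecond_nonneg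

lemma winProb_le_one (hp : ∀ j, 0 ≤ p j) (hs : ∑ j, p j ≤ 1) : winProb p x i ≤ 1 := by
  rw [← mix_const (p := p) (i := i) 1]
  exact mix_mono hp hs le_rfl (fun j => winsSecond_le_one) winsSecond_le_one

lemma grossPayoff_nonneg (hp : ∀ j, 0 ≤ p j) (hs : ∑ j, p j ≤ 1) (hx : 0 ≤ x i) :
    0 ≤ grossPayoff p x i := by
  rw [← mix_const (p := p) (i := i) 0]
  exact mix_mono hp hs hx (fun j => secondPeriodPayoff_nonneg) secondPeriodPayoff_nonneg

lemma grossPayoff_le (hN : 3 ≤ N) (hp : ∀ j, 0 ≤ p j) (hs : ∑ j, p j ≤ 1) (hx : ∀ j, 0 ≤ x j) :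
    grossPayoff p x i ≤ x i := by
  conv_rhs => rw [← mix_const (p := p) (i := i) (x i)]
  exact mix_mono hp hs le_rfl (fun j => secondPeriodPayoff_le hN hx) (secondPeriodPayoff_le hN hx)

/-- The payoff is the positive part of own value minus a price set by rivals, convex in the own
value with the win indicator as a subgradient. -/
lemma secondPeriodPayoff_subgradient {w : Option (Fin N)} (v : ℝ) :
    secondPeriodPayoff x i w + winsSecond x i w * (v - x i)
      ≤ secondPeriodPayoff (Function.update x i v) i w := by
  rw [secondPeriodPayoff_eq, secondPeriodPayoff_eq, rivalMax_update, Function.update_self,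
    winsSecond]
  split_ifs with h
  · rw [max_eq_left (by linarith)]
    exact le_max_of_le_left (by linarith)
  · rw [max_eq_right (by linarith)]
    exact le_max_of_le_right (by linarith)

lemma grossPayoff_subgradient (hp : ∀ j, 0 ≤ p j) (hs : ∑ j, p j ≤ 1) (v : ℝ) :
    grossPayoff p x i + winProb p x i * (v - x i) ≤ grossPayoff p (Function.update x i v) i := by
  rw [grossPayoff_eq_mix, winProb, ← mix_add_mul]
  refine mix_mono hp hs ?_ (fun j => secondPeriodPayoff_subgradient v)
    (secondPeriodPayoff_subgradient v)
  rw [Function.update_self]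
  linarith

section Measurability

variable {α : Type*} [MeasurableSpace α] {P g : α → Fin N → ℝ}

lemma measurable_rivalMax (i : Fin N) (w : Option (Fin N)) :
    Measurable fun x : Fin N → ℝ => rivalMax x i w :=
  Measurable.iSup fun _ => measurable_pi_apply _

lemma measurable_mix (hP : ∀ j, Measurable fun a => P a j) {A : α → Fin N → ℝ} {b B : α → ℝ}
    (hb : Measurable b) (hA : ∀ j, Measurable fun a => A a j) (hB : Measurable B) :
    Measurable fun a => mix (P a) i (b a) (A a) (B a) := by
  unfold mix
  refine (((hP i).mul hb).add (Finset.measurable_sum _ fun j _ => (hP j).mul (hA j))).add ?_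
  exact (measurable_const.sub (Finset.measurable_sum _ fun j _ => hP j)).mul hB

lemma measurable_secondPeriodPayoff (i : Fin N) (w : Option (Fin N)) :
    Measurable fun x : Fin N → ℝ => secondPeriodPayoff x i w :=
  ((measurable_pi_apply i).sub (measurable_rivalMax i w)).max measurable_const

lemma measurable_winsSecond (i : Fin N) (w : Option (Fin N)) :
    Measurable fun x : Fin N → ℝ => winsSecond x i w :=
  Measurable.ite (measurableSet_lt (measurable_rivalMax i w) (measurable_pi_apply i))
    measurable_const measurable_const

lemma measurable_grossPayoff (hP : ∀ j, Measurable fun a => P a j) (hg : Measurable g)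
    (i : Fin N) : Measurable fun a => grossPayoff (P a) (g a) i :=
  measurable_mix hP ((measurable_pi_apply i).comp hg)
    (fun j => (measurable_secondPeriodPayoff i (some j)).comp hg)
    ((measurable_secondPeriodPayoff i none).comp hg)

lemma measurable_winProb (hP : ∀ j, Measurable fun a => P a j) (hg : Measurable g)
    (i : Fin N) : Measurable fun a => winProb (P a) (g a) i :=
  measurable_mix hP measurable_const
    (fun j => (measurable_winsSecond i (some j)).comp hg)
    ((measurable_winsSecond i none).comp hg)

end Measurability

end Mix

/-! ### The revenue of incentive compatible mechanisms -/

section Revenue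

variable {N : ℕ} {μ : Measure ℝ} {f : ℝ → ℝ} {lo hi : ℝ} {M : Mechanism N}

lemma update_mem_Icc {x : Fin N → ℝ} (hx : ∀ j, x j ∈ Icc lo hi) {i : Fin N} {q : ℝ}
    (hq : q ∈ Icc lo hi) (j : Fin N) : Function.update x i q j ∈ Icc lo hi := by
  by_cases hj : j = i
  · subst hj; simpa using hq
  · rw [Function.update_of_ne hj]; exact hx j

lemma interimPayoff_truthful (i : Fin N) (v q : ℝ) :
    interimPayoff μ M (truthful N) i v q = ∫ x, payoff M (Function.update x i q)
      (Function.update x i v) i ∂(Measure.pi fun _ : Fin N => μ) := rfl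

lemma IsDirectMechanism.measurable_alloc_comp (hM : IsDirectMechanism μ lo hi M)
    {α : Type*} [MeasurableSpace α] {g : α → Fin N → ℝ} (hg : Measurable g) (j : Fin N) :
    Measurable fun a => M.alloc (g a) j := (hM.measurable_alloc j).comp hg

lemma integrable_grossPayoff (hN : 3 ≤ N) (h : IsValueDistribution μ f lo hi)
    (hM : IsDirectMechanism μ lo hi M) (i : Fin N) :
    Integrable (fun x => grossPayoff (M.alloc x) x i) (Measure.pi fun _ : Fin N => μ) := by
  have := h.isProbabilityMeasure
  refine Integrable.of_bound (measurable_grossPayoff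
    (hM.measurable_alloc_comp measurable_id) measurable_id i).aestronglyMeasurable hi ?_
  filter_upwards [ae_pi_mem h.ae_mem_Icc] with x hx
  have hp := hM.alloc_nonneg x hx
  have hs := hM.sum_alloc_le_one x hx
  have hx0 : ∀ j, 0 ≤ x j := fun j => h.lo_nonneg.trans (hx j).1
  rw [Real.norm_eq_abs, abs_of_nonneg (grossPayoff_nonneg hp hs (hx0 i))]
  exact (grossPayoff_le hN hp hs hx0).trans (hx i).2

lemma integrable_payoff (hN : 3 ≤ N) (h : IsValueDistribution μ f lo hi)
    (hM : IsDirectMechanism μ lo hi M) (i : Fin N) :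
    Integrable (fun x => payoff M x x i) (Measure.pi fun _ : Fin N => μ) :=
  (integrable_grossPayoff hN h hM i).sub (hM.integrable_pay i)

lemma integrable_interim_payoff (hN : 3 ≤ N) (h : IsValueDistribution μ f lo hi)
    (hM : IsDirectMechanism μ lo hi M) (i : Fin N) {q v : ℝ} (hq : q ∈ Icc lo hi)
    (hv : v ∈ Icc lo hi) :
    Integrable (fun x => payoff M (Function.update x i q) (Function.update x i v) i)
      (Measure.pi fun _ : Fin N => μ) := by
  have := h.isProbabilityMeasure
  refine Integrable.sub ?_ (hM.integrable_interim_pay i q hq)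
  refine Integrable.of_bound (measurable_grossPayoff
    (hM.measurable_alloc_comp measurable_update_left)
    measurable_update_left i).aestronglyMeasurable hi ?_
  filter_upwards [ae_pi_mem h.ae_mem_Icc] with x hx
  have hp := hM.alloc_nonneg _ (update_mem_Icc hx hq (i := i))
  have hs := hM.sum_alloc_le_one _ (update_mem_Icc hx hq (i := i))
  have hx0 : ∀ j, 0 ≤ Function.update x i v j :=
    fun j => h.lo_nonneg.trans (update_mem_Icc hx hv j).1
  rw [Real.norm_eq_abs, abs_of_nonneg (grossPayoff_nonneg hp hs (hx0 i))]
  exact (grossPayoff_le hN hp hs hx0).trans (update_mem_Icc hx hv i).2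

/-- The interim probability that buyer `i` with value `s` obtains one of the units. -/
def interimWinProb (μ : Measure ℝ) (M : Mechanism N) (i : Fin N) (s : ℝ) : ℝ :=
  ∫ x, winProb (M.alloc (Function.update x i s)) (Function.update x i s) i
    ∂(Measure.pi fun _ : Fin N => μ)

lemma measurable_interimWinProb [IsProbabilityMeasure μ] (hM : IsDirectMechanism μ lo hi M)
    (i : Fin N) : Measurable (interimWinProb μ M i) := by
  have : StronglyMeasurable (Function.uncurry fun (x : Fin N → ℝ) (s : ℝ) =>
      winProb (M.alloc (Function.update x i s)) (Function.update x i s) i) :=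
    (measurable_winProb (hM.measurable_alloc_comp (measurable_update_prod i))
      (measurable_update_prod i) i).stronglyMeasurable
  exact this.integral_prod_left.measurable

lemma integrable_interim_winProb (h : IsValueDistribution μ f lo hi)
    (hM : IsDirectMechanism μ lo hi M) (i : Fin N) {s : ℝ} (hs : s ∈ Icc lo hi) :
    Integrable (fun x => winProb (M.alloc (Function.update x i s)) (Function.update x i s) i)
      (Measure.pi fun _ : Fin N => μ) := by
  have := h.isProbabilityMeasure
  refine Integrable.of_bound (measurable_winProb
    (hM.measurable_alloc_comp measurable_update_left)
    measurable_update_left i).aestronglyMeasurable 1 ?_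
  filter_upwards [ae_pi_mem h.ae_mem_Icc] with x hx
  have hp := hM.alloc_nonneg _ (update_mem_Icc hx hs (i := i))
  have hs := hM.sum_alloc_le_one _ (update_mem_Icc hx hs (i := i))
  rw [Real.norm_eq_abs, abs_of_nonneg (winProb_nonneg hp hs)]
  exact winProb_le_one hp hs

lemma interimWinProb_mem (h : IsValueDistribution μ f lo hi)
    (hM : IsDirectMechanism μ lo hi M) (i : Fin N) {s : ℝ} (hs : s ∈ Icc lo hi) :
    0 ≤ interimWinProb μ M i s ∧ interimWinProb μ M i s ≤ 1 := by
  have := h.isProbabilityMeasure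
  have hmem := ae_pi_mem (N := N) h.ae_mem_Icc
  constructor
  · refine integral_nonneg_of_ae ?_
    filter_upwards [hmem] with x hx
    exact winProb_nonneg (hM.alloc_nonneg _ (update_mem_Icc hx hs (i := i)))
      (hM.sum_alloc_le_one _ (update_mem_Icc hx hs (i := i)))
  · calc interimWinProb μ M i s ≤ ∫ _, (1 : ℝ) ∂(Measure.pi fun _ : Fin N => μ) := by
          refine integral_mono_ae (integrable_interim_winProb h hM i hs) (integrable_const _) ?_
          filter_upwards [hmem] with x hx
          exact winProb_le_one (hM.alloc_nonneg _ (update_mem_Icc hx hs (i := i)))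
            (hM.sum_alloc_le_one _ (update_mem_Icc hx hs (i := i)))
      _ = 1 := by simp

/-- By incentive compatibility, the interim winning probability is a subgradient of the interim
payoff. -/
lemma interimPayoff_subgradient (hN : 3 ≤ N) (h : IsValueDistribution μ f lo hi)
    (hM : IsDirectMechanism μ lo hi M) (hIC : IsBayesNashEquilibrium μ lo hi M (truthful N))
    (i : Fin N) {s t : ℝ} (hs : s ∈ Icc lo hi) (ht : t ∈ Icc lo hi) :
    interimPayoff μ M (truthful N) i s s + interimWinProb μ M i s * (t - s)
      ≤ interimPayoff μ M (truthful N) i t t := by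
  have := h.isProbabilityMeasure
  -- Type `t` does not gain by reporting `s`. The payoff from that imitation lies pointwise above
  -- the tangent line at `s`, because reports and hence allocation and payment stay fixed.
  refine le_trans ?_ (hIC i t ht s hs)
  rw [interimPayoff_truthful, interimPayoff_truthful, interimWinProb, ← integral_mul_const,
    ← integral_add (integrable_interim_payoff hN h hM i hs hs)
      ((integrable_interim_winProb h hM i hs).mul_const _)]
  refine integral_mono_ae ((integrable_interim_payoff hN h hM i hs hs).add
    ((integrable_interim_winProb h hM i hs).mul_const _))
    (integrable_interim_payoff hN h hM i hs ht) ?_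
  filter_upwards [ae_pi_mem h.ae_mem_Icc] with x hx
  have := grossPayoff_subgradient (i := i) (x := Function.update x i s)
    (hM.alloc_nonneg _ (update_mem_Icc hx hs (i := i)))
    (hM.sum_alloc_le_one _ (update_mem_Icc hx hs (i := i))) t
  rw [Function.update_self, Function.update_idem] at this
  simp only [payoff]
  linarith

lemma integrable_winProb_mul_invHazard (h : IsValueDistribution μ f lo hi)
    (hM : IsDirectMechanism μ lo hi M) (i : Fin N) :
    Integrable (fun x => winProb (M.alloc x) x i * invHazard μ f (x i))
      (Measure.pi fun _ : Fin N => μ) := by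
  have := h.isProbabilityMeasure
  have hh : Integrable (fun x : Fin N → ℝ => invHazard μ f (x i))
      (Measure.pi fun _ : Fin N => μ) :=
    (measurePreserving_eval (fun _ : Fin N => μ) i).integrable_comp_of_integrable
      h.integrable_invHazard
  refine hh.bdd_mul (c := 1) (measurable_winProb (hM.measurable_alloc_comp measurable_id)
    measurable_id i).aestronglyMeasurable ?_
  filter_upwards [ae_pi_mem h.ae_mem_Icc] with x hx
  have hp := hM.alloc_nonneg x hx
  have hs := hM.sum_alloc_le_one x hx
  rw [Real.norm_eq_abs, abs_of_nonneg (winProb_nonneg hp hs)]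
  exact winProb_le_one hp hs

/-- The envelope formula for the expected payoff of a buyer. -/
lemma integral_payoff (hN : 3 ≤ N) (h : IsValueDistribution μ f lo hi)
    (hψ : MonotoneOn (virtualValue μ f) (Icc lo hi))
    (hM : IsDirectMechanism μ lo hi M) (hIC : IsBayesNashEquilibrium μ lo hi M (truthful N))
    (i : Fin N) :
    ∫ x, payoff M x x i ∂(Measure.pi fun _ : Fin N => μ)
      = interimPayoff μ M (truthful N) i lo lo
        + ∫ x, winProb (M.alloc x) x i * invHazard μ f (x i)
          ∂(Measure.pi fun _ : Fin N => μ) := by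
  have := h.isProbabilityMeasure
  have hint := integrable_payoff hN h hM i
  rw [integral_resample i hint, integral_resample i (integrable_winProb_mul_invHazard h hM i)]
  simp only [Function.update_self, integral_mul_const]
  have hU : ∀ᵐ v ∂μ, ∫ s in lo..v, interimWinProb μ M i s
      = interimPayoff μ M (truthful N) i v v - interimPayoff μ M (truthful N) i lo lo := by
    filter_upwards [h.ae_mem_Icc] with v hv
    exact integral_eq_sub_of_subgradient
      (U := fun v => interimPayoff μ M (truthful N) i v v)
      (fun s hs t ht => interimPayoff_subgradient hN h hM hIC i hs ht)
      (fun s hs => interimWinProb_mem h hM i hs) hv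
  have hparts := h.integral_integral_eq hψ (measurable_interimWinProb hM i)
    (fun s hs => interimWinProb_mem h hM i hs)
  have hUint : Integrable (fun v => interimPayoff μ M (truthful N) i v v) μ :=
    integrable_resample i hint
  rw [integral_congr_ae hU, integral_sub hUint (integrable_const _)]
    at hparts
  simp only [integral_const, probReal_univ, one_smul, interimPayoff_truthful] at hparts ⊢
  unfold interimWinProb at hparts
  linarith

/-- The sum of the buyers' gross payoffs, net of their information rents. -/
def virtualSurplus (μ : Measure ℝ) (f : ℝ → ℝ) (p x : Fin N → ℝ) : ℝ :=
  ∑ i, (grossPayoff p x i - winProb p x i * invHazard μ f (x i))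

lemma integrable_grossPayoff_sub (hN : 3 ≤ N) (h : IsValueDistribution μ f lo hi)
    (hM : IsDirectMechanism μ lo hi M) (i : Fin N) :
    Integrable (fun x => grossPayoff (M.alloc x) x i
      - winProb (M.alloc x) x i * invHazard μ f (x i)) (Measure.pi fun _ : Fin N => μ) :=
  (integrable_grossPayoff hN h hM i).sub (integrable_winProb_mul_invHazard h hM i)

lemma integrable_virtualSurplus (hN : 3 ≤ N) (h : IsValueDistribution μ f lo hi)
    (hM : IsDirectMechanism μ lo hi M) :
    Integrable (fun x => virtualSurplus μ f (M.alloc x) x) (Measure.pi fun _ : Fin N => μ) :=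
  integrable_finsetSum _ fun i _ => integrable_grossPayoff_sub hN h hM i

lemma expectedRevenue_eq_integral_virtualSurplus (hN : 3 ≤ N) (h : IsValueDistribution μ f lo hi)
    (hψ : MonotoneOn (virtualValue μ f) (Icc lo hi))
    (hM : IsDirectMechanism μ lo hi M) (hIC : IsBayesNashEquilibrium μ lo hi M (truthful N)) :
    expectedRevenue μ M = ∫ x, virtualSurplus μ f (M.alloc x) x ∂(Measure.pi fun _ : Fin N => μ)
      - ∑ i, interimPayoff μ M (truthful N) i lo lo := by
  unfold expectedRevenue virtualSurplus
  rw [integral_finsetSum _ fun i _ => hM.integrable_pay i,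
    integral_finsetSum _ fun i _ => integrable_grossPayoff_sub hN h hM i, ← Finset.sum_sub_distrib]
  refine Finset.sum_congr rfl fun i _ => ?_
  have hpay : ∫ x, M.pay x i ∂(Measure.pi fun _ : Fin N => μ)
      = ∫ x, grossPayoff (M.alloc x) x i ∂(Measure.pi fun _ : Fin N => μ)
        - ∫ x, payoff M x x i ∂(Measure.pi fun _ : Fin N => μ) := by
    rw [← integral_sub (integrable_grossPayoff hN h hM i) (integrable_payoff hN h hM i)]
    simp [payoff]
  rw [hpay, integral_payoff hN h hψ hM hIC i, integral_sub (integrable_grossPayoff hN h hM i)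
      (integrable_winProb_mul_invHazard h hM i)]
  ring

/-- The mechanism that never sells and never charges anything. -/
def nullMechanism (N : ℕ) : Mechanism N := ⟨0, 0⟩

lemma isDirectMechanism_nullMechanism :
    IsDirectMechanism μ lo hi (nullMechanism N) where
  measurable_alloc _ := measurable_const
  measurable_pay _ := measurable_const
  alloc_nonneg _ _ _ := le_rfl
  sum_alloc_le_one _ _ := by simp [nullMechanism]
  integrable_pay _ := integrable_zero _ _ _
  integrable_interim_pay _ _ _ := integrable_zero _ _ _

lemma integral_secondPeriodPayoff_lo (hN : 3 ≤ N) (h : IsValueDistribution μ f lo hi)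
    (i : Fin N) : ∫ x, secondPeriodPayoff (Function.update x i lo) i none
      ∂(Measure.pi fun _ : Fin N => μ) = 0 := by
  have := h.isProbabilityMeasure
  refine integral_eq_zero_of_ae ?_
  filter_upwards [ae_pi_mem h.ae_mem_Icc] with x hx
  refine secondPeriodPayoff_eq_zero hN fun j => ?_
  rw [Function.update_self]
  exact (update_mem_Icc hx ⟨le_rfl, h.lo_lt_hi.le⟩ j).1

lemma payoff_nullMechanism (b x : Fin N → ℝ) (i : Fin N) :
    payoff (nullMechanism N) b x i = secondPeriodPayoff x i none := by
  simp only [payoff, nullMechanism, Pi.zero_apply, grossPayoff_zero, sub_zero]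

lemma interimPayoff_nullMechanism (i : Fin N) (v q : ℝ) :
    interimPayoff μ (nullMechanism N) (truthful N) i v q
      = ∫ x, secondPeriodPayoff (Function.update x i v) i none
        ∂(Measure.pi fun _ : Fin N => μ) := by
  rw [interimPayoff]
  simp_rw [payoff_nullMechanism]

lemma expectedRevenue_nullMechanism : expectedRevenue μ (nullMechanism N) = 0 := by
  rw [expectedRevenue, nullMechanism]
  simp

lemma isBayesNashEquilibrium_nullMechanism :
    IsBayesNashEquilibrium μ lo hi (nullMechanism N) (truthful N) := by
  intro i v _ q _
  rw [interimPayoff_nullMechanism, interimPayoff_nullMechanism]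

lemma integrable_virtualSurplus_zero (hN : 3 ≤ N) (h : IsValueDistribution μ f lo hi) :
    Integrable (fun x => virtualSurplus μ f (0 : Fin N → ℝ) x)
      (Measure.pi fun _ : Fin N => μ) := by
  have := integrable_virtualSurplus hN h (isDirectMechanism_nullMechanism (N := N))
  simpa only [nullMechanism, Pi.zero_apply] using this

/-- Read off from the revenue formula for the null mechanism, whose revenue and lowest-type payoffs
are zero; no direct computation is needed. -/
lemma integral_virtualSurplus_zero (hN : 3 ≤ N) (h : IsValueDistribution μ f lo hi)
    (hψ : MonotoneOn (virtualValue μ f) (Icc lo hi)) :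
    ∫ x, virtualSurplus μ f (0 : Fin N → ℝ) x ∂(Measure.pi fun _ : Fin N => μ) = 0 := by
  have hrev := expectedRevenue_eq_integral_virtualSurplus hN h hψ
    (isDirectMechanism_nullMechanism (N := N)) isBayesNashEquilibrium_nullMechanism
  simp only [interimPayoff_nullMechanism, integral_secondPeriodPayoff_lo hN h,
    Finset.sum_const_zero, sub_zero, expectedRevenue_nullMechanism] at hrev
  simpa only [nullMechanism, Pi.zero_apply] using hrev.symm

/-- The expected revenue in terms of the gain in virtual surplus over the null mechanism. -/
lemma expectedRevenue_eq (hN : 3 ≤ N) (h : IsValueDistribution μ f lo hi)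
    (hψ : MonotoneOn (virtualValue μ f) (Icc lo hi))
    (hM : IsDirectMechanism μ lo hi M) (hIC : IsBayesNashEquilibrium μ lo hi M (truthful N)) :
    expectedRevenue μ M = ∫ x, (virtualSurplus μ f (M.alloc x) x - virtualSurplus μ f 0 x)
        ∂(Measure.pi fun _ : Fin N => μ)
      - ∑ i, interimPayoff μ M (truthful N) i lo lo := by
  rw [expectedRevenue_eq_integral_virtualSurplus hN h hψ hM hIC,
    integral_sub (integrable_virtualSurplus hN h hM)
      (integrable_virtualSurplus_zero hN h), integral_virtualSurplus_zero hN h hψ, sub_zero]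

end Revenue

/-! ### Pointwise maximization of the virtual surplus -/

section Gain

variable {N : ℕ} {μ : Measure ℝ} {f : ℝ → ℝ} {lo hi : ℝ} {p x : Fin N → ℝ} {i j k l : Fin N}
  {w : Option (Fin N)}

/-- Payoff of buyer `i` in the second auction net of the information rent. -/
def netSecond (μ : Measure ℝ) (f : ℝ → ℝ) (x : Fin N → ℝ) (i : Fin N) (w : Option (Fin N)) : ℝ :=
  secondPeriodPayoff x i w - winsSecond x i w * invHazard μ f (x i)

/-- The increase of the virtual surplus if the first unit goes to buyer `j`. -/
def gain (μ : Measure ℝ) (f : ℝ → ℝ) (x : Fin N → ℝ) (j : Fin N) : ℝ :=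
  ∑ i, ((if j = i then x i - invHazard μ f (x i) else netSecond μ f x i (some j))
    - netSecond μ f x i none)

lemma mix_eq (a : ℝ) (A : Fin N → ℝ) (A₀ : ℝ) :
    mix p i a A A₀ = A₀ + ∑ j, p j * ((if j = i then a else A j) - A₀) := by
  unfold mix
  have h1 : ∑ j ∈ Finset.univ.erase i, p j * (if j = i then a else A j)
      = ∑ j ∈ Finset.univ.erase i, p j * A j :=
    Finset.sum_congr rfl fun j hj => by rw [if_neg (Finset.ne_of_mem_erase hj)]
  simp_rw [mul_sub, Finset.sum_sub_distrib, ← Finset.sum_mul]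
  rw [← Finset.add_sum_erase _ (fun j => p j * (if j = i then a else A j)) (Finset.mem_univ i),
    h1, if_pos rfl]
  ring

lemma virtualSurplus_eq :
    virtualSurplus μ f p x = ∑ i, netSecond μ f x i none + ∑ j, p j * gain μ f x j := by
  have h : ∀ i, grossPayoff p x i - winProb p x i * invHazard μ f (x i)
      = netSecond μ f x i none + ∑ j, p j * ((if j = i then x i - invHazard μ f (x i) else
        netSecond μ f x i (some j)) - netSecond μ f x i none) := fun i => by
    rw [← mix_eq (x i - invHazard μ f (x i)) (fun j => netSecond μ f x i (some j)),
      sub_eq_add_neg, ← mul_neg, grossPayoff_eq_mix, winProb, ← mix_add_mul]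
    congr 1
    · ring
    · ext j; unfold netSecond; ring
    · unfold netSecond; ring
  unfold virtualSurplus gain
  simp_rw [h]
  rw [Finset.sum_add_distrib, Finset.sum_comm]
  simp_rw [Finset.mul_sum]

lemma virtualSurplus_sub :
    virtualSurplus μ f p x - virtualSurplus μ f 0 x = ∑ j, p j * gain μ f x j := by
  rw [virtualSurplus_eq, virtualSurplus_eq]
  simp

lemma netSecond_eq_zero (hj : j ≠ i) (hw : w ≠ some j) (hle : x i ≤ x j) :
    netSecond μ f x i w = 0 := by
  have hm : x j ≤ rivalMax x i w :=
    le_ciSup (f := fun j : {j : Fin N // j ≠ i ∧ w ≠ some j} => x j)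
      (Set.finite_range _).bddAbove ⟨j, hj, hw⟩
  rw [netSecond, secondPeriodPayoff_eq, winsSecond, if_neg (by linarith),
    max_eq_right (by linarith)]
  ring

lemma netSecond_eq (hj : j ≠ i) (hw : w ≠ some j) (h : ∀ l, l ≠ i → w ≠ some l → x l ≤ x j)
    (hlt : x j < x i) : netSecond μ f x i w = x i - x j - invHazard μ f (x i) := by
  rw [netSecond, secondPeriodPayoff_eq, winsSecond, rivalMax_eq hj hw h, if_pos hlt,
    max_eq_left (by linarith)]
  ring

variable (hij : x j < x i) (hjk : x k < x j) (h : ∀ l, l ≠ i → l ≠ j → x l ≤ x k)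
include hij hjk h

lemma netSecond_none_top : netSecond μ f x i none = x i - x j - invHazard μ f (x i) := by
  refine netSecond_eq (fun e => by rw [e] at hij; exact lt_irrefl _ hij) (by simp) ?_ hij
  intro l hl _
  by_cases hlj : l = j
  · rw [hlj]
  · exact (h l hl hlj).trans hjk.le

lemma netSecond_of_ne_top (hl : l ≠ i) (hw : w ≠ some i) : netSecond μ f x l w = 0 := by
  refine netSecond_eq_zero hl.symm hw ?_
  by_cases hlj : l = j
  · rw [hlj]; exact hij.le
  · exact (h l hl hlj).trans (hjk.trans hij).le

/-- Buyer `i` would have won the second unit anyway at price `x j`, so he only saves that price, and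
`j` now wins the second unit at price `x k`. -/
lemma gain_of_top : gain μ f x i = x j - invHazard μ f (x j) + x j - x k := by
  have hne : i ≠ j := fun e => by rw [e] at hij; exact lt_irrefl _ hij
  have hkj : k ≠ j := fun e => by rw [e] at hjk; exact lt_irrefl _ hjk
  have hki : k ≠ i := fun e => by rw [e] at hjk; exact lt_irrefl _ (hjk.trans hij)
  unfold gain
  rw [Fintype.sum_eq_add i j hne]
  · rw [if_pos rfl, if_neg hne, netSecond_none_top hij hjk h,
      netSecond_of_ne_top hij hjk h hne.symm (w := none) (by simp),
      netSecond_eq (j := k) hkj (by simpa using hki.symm) _ hjk]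
    · ring
    · intro l hl hl'
      exact h l (fun e => hl' (by rw [e])) hl
  · rintro l ⟨hli, hlj⟩
    rw [if_neg hli.symm, netSecond_of_ne_top hij hjk h hli (w := none) (by simp),
      netSecond_eq_zero (j := j) hlj.symm (by simpa using hne) ((h l hli hlj).trans hjk.le),
      sub_zero]

/-- Buyer `j` contributes his virtual value, and the price of `i` in the second auction falls from
`x j` to `x k`. -/
lemma gain_of_second : gain μ f x j = x j - invHazard μ f (x j) + x j - x k := by
  have hne : i ≠ j := fun e => by rw [e] at hij; exact lt_irrefl _ hij
  have hkj : k ≠ j := fun e => by rw [e] at hjk; exact lt_irrefl _ hjk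
  have hki : k ≠ i := fun e => by rw [e] at hjk; exact lt_irrefl _ (hjk.trans hij)
  unfold gain
  rw [Fintype.sum_eq_add i j hne]
  · rw [if_pos rfl, if_neg hne.symm, netSecond_none_top hij hjk h,
      netSecond_of_ne_top hij hjk h hne.symm (w := none) (by simp),
      netSecond_eq (j := k) hki (by simpa using hkj.symm) _ (hjk.trans hij)]
    · ring
    · intro l hl hl'
      exact h l hl (fun e => hl' (by rw [e]))
  · rintro l ⟨hli, hlj⟩
    rw [if_neg hlj.symm, netSecond_of_ne_top hij hjk h hli (w := none) (by simp),
      netSecond_of_ne_top hij hjk h hli (by simpa using hne.symm), sub_zero]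

/-- Removing `l` leaves the winner and the price of the second auction unchanged. -/
lemma gain_of_low (hli : l ≠ i) (hlj : l ≠ j) : gain μ f x l = x l - invHazard μ f (x l) := by
  have hne : i ≠ j := fun e => by rw [e] at hij; exact lt_irrefl _ hij
  unfold gain
  rw [Fintype.sum_eq_single l]
  · rw [if_pos rfl, netSecond_of_ne_top hij hjk h hli (w := none) (by simp), sub_zero]
  · intro m hm
    rw [if_neg hm.symm]
    by_cases hmi : m = i
    · subst hmi
      rw [netSecond_none_top hij hjk h, netSecond_eq (j := j) hne.symm (by simpa using hlj) _ hij,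
        sub_self]
      intro l' hl' _
      by_cases hlj' : l' = j
      · rw [hlj']
      · exact (h l' hl' hlj').trans hjk.le
    · rw [netSecond_of_ne_top hij hjk h hmi (w := none) (by simp),
        netSecond_of_ne_top hij hjk h hmi (by simpa using hli), sub_zero]

end Gain

/-! ### The modified third-price auction as a direct mechanism -/

section Feasible

variable {N : ℕ} {μ : Measure ℝ} {f : ℝ → ℝ} {lo hi : ℝ} {ψ : ℝ → EReal}
  {σ : Equiv.Perm (Fin N)} {τ : Equiv.Perm (Fin N) → ℝ} {b x : Fin N → ℝ} {i : Fin N}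

lemma measurable_kthHighest (hN : 3 ≤ N) {n : ℕ} (hn : n = 2 ∨ n = 3) :
    Measurable fun b : Fin N → ℝ => kthHighest b n := by
  refine measurable_of_Ici fun c => ?_
  have : (fun b : Fin N → ℝ => kthHighest b n) ⁻¹' Ici c
      = {b | n ≤ ∑ j, if c ≤ b j then 1 else 0} := by
    ext b
    simp only [mem_preimage, mem_Ici, le_kthHighest_iff hN hn, Finset.card_filter, mem_ofPred_eq]
  rw [this]
  exact measurableSet_le measurable_const (Finset.measurable_sum _ fun j _ =>
    Measurable.ite (measurableSet_le measurable_const (measurable_pi_apply j))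
      measurable_const measurable_const)

lemma measurable_position (σ : Equiv.Perm (Fin N)) (i : Fin N) :
    Measurable fun b : Fin N → ℝ => position σ b i := by
  classical
  have : (fun b : Fin N → ℝ => position σ b i)
      = fun b => (∑ j, if RankedAbove σ b j i then 1 else 0) + 1 := by
    ext b
    simp only [position, Finset.card_filter]
  rw [this]
  have hsum : Measurable fun b : Fin N → ℝ => ∑ j, if RankedAbove σ b j i then (1 : ℕ) else 0 := by
    refine Finset.measurable_sum _ fun j _ => Measurable.ite ?_ measurable_const measurable_const
    have hlt := measurableSet_lt (measurable_pi_apply (X := fun _ : Fin N => ℝ) i)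
      (measurable_pi_apply j)
    have heq := measurableSet_eq_fun (measurable_pi_apply (X := fun _ : Fin N => ℝ) i)
      (measurable_pi_apply j)
    exact hlt.union (heq.inter (MeasurableSet.const _))
  exact hsum.add_const 1

lemma measurable_threshold (hψ : 0 ≤ ψ hi) (hlo : lo ≤ hi) :
    Measurable (threshold ψ lo hi) := by
  -- Capping at `hi` keeps the sets nonempty, and they shrink as `x` grows. Beyond `hi` the set is
  -- empty and `sInf` returns `0`, which breaks monotonicity but not measurability.
  have hmono : Monotone fun x => threshold ψ lo hi (min x hi) := by
    intro x y hxy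
    refine csInf_le_csInf bddBelow_thresholdSet
      (thresholdSet_nonempty hψ (min_le_right _ _) hlo) ?_
    have hle : min x hi ≤ min y hi := min_le_min_right _ hxy
    rintro a ⟨h1, h2, h3⟩
    exact ⟨h1, hle.trans h2, le_trans (by exact_mod_cast hle) h3⟩
  have heq : threshold ψ lo hi
      = fun x => if x ≤ hi then threshold ψ lo hi (min x hi) else 0 := by
    ext x
    split_ifs with hx
    · rw [min_eq_left hx]
    · have : thresholdSet ψ lo hi x = ∅ := by
        rw [eq_empty_iff_forall_notMem]
        rintro a ⟨h1, h2, -⟩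
        exact hx (h2.trans h1.2)
      rw [threshold_eq, this, Real.sInf_empty]
  rw [heq]
  exact Measurable.ite measurableSet_Iic hmono.measurable measurable_const

lemma IsValueDistribution.measurableSet_virtualValue_neg (h : IsValueDistribution μ f lo hi) :
    MeasurableSet {v | virtualValue μ f v < 0} := by
  have : {v | virtualValue μ f v < 0} = {v : ℝ | (v : EReal)
      < ((ENNReal.ofReal (1 - cdf μ v) / ENNReal.ofReal (f v) : ENNReal) : EReal)} := by
    ext v
    simp only [mem_ofPred_eq, virtualValue]
    rw [EReal.sub_neg (Or.inl (EReal.coe_ne_top v)) (Or.inl (EReal.coe_ne_bot v))]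
  rw [this]
  exact measurableSet_lt measurable_coe_real_ereal
    (((measurable_const.sub (monotone_cdf μ).measurable).ennreal_ofReal.div
      h.measurable_density.ennreal_ofReal).coe_ereal_ennreal)

lemma measurableSet_isAllocated (hN : 3 ≤ N) (hψ : 0 ≤ ψ hi) (hlo : lo ≤ hi) :
    MeasurableSet {b : Fin N → ℝ | IsAllocated ψ lo hi b} :=
  measurableSet_le ((measurable_threshold hψ hlo).comp (measurable_kthHighest hN (Or.inr rfl)))
    (measurable_kthHighest hN (Or.inl rfl))

lemma measurable_thirdPriceAlloc (hN : 3 ≤ N) (hψ : 0 ≤ ψ hi) (hlo : lo ≤ hi) :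
    Measurable fun b : Fin N → ℝ => thirdPriceAlloc ψ lo hi σ b i := by
  classical
  exact Measurable.ite ((measurableSet_isAllocated hN hψ hlo).inter
    (measurable_position σ i (measurableSet_singleton 2))) measurable_const measurable_const

lemma measurable_thirdPricePay (hN : 3 ≤ N) (hψ : 0 ≤ ψ hi) (hlo : lo ≤ hi)
    (hneg : MeasurableSet {v | ψ v < 0}) :
    Measurable fun b : Fin N → ℝ => thirdPricePay ψ lo hi σ b i := by
  classical
  have h3 := measurable_kthHighest hN (Or.inr rfl : 3 = 2 ∨ 3 = 3)
  have ha := (measurable_threshold hψ hlo).comp h3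
  exact Measurable.ite (measurableSet_isAllocated hN hψ hlo)
    (Measurable.ite (measurable_position σ i (measurableSet_singleton 1))
      (Measurable.ite (h3 hneg) (ha.sub h3) measurable_const)
      (Measurable.ite (measurable_position σ i (measurableSet_singleton 2))
        (Measurable.ite (h3 hneg) ha h3) measurable_const)) measurable_const

lemma thirdPricePay_mem (hN : 3 ≤ N) (hψ : 0 ≤ ψ hi) (hlo0 : 0 ≤ lo) (hlo : lo ≤ hi)
    (hb : ∀ j, b j ∈ Icc lo hi) : thirdPricePay ψ lo hi σ b i ∈ Icc 0 hi := by
  obtain ⟨k, hk, -⟩ := exists_kthHighest_eq hN b (Or.inr rfl : 3 = 2 ∨ 3 = 3)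
  have h3 : kthHighest b 3 ∈ Icc lo hi := hk ▸ hb k
  have hne := thresholdSet_nonempty hψ h3.2 hlo
  have ha := threshold_mem_Icc hne
  have ha' := le_threshold hne
  have h0 : (0 : ℝ) ∈ Icc 0 hi := ⟨le_rfl, hlo0.trans hlo⟩
  unfold thirdPricePay
  split_ifs
  · exact ⟨by linarith, by linarith [ha.2, h3.1]⟩
  · exact h0
  · exact ⟨by linarith [ha.1], ha.2⟩
  · exact ⟨by linarith [h3.1], h3.2⟩
  · exact h0
  · exact h0

lemma modifiedThirdPriceAuction_pay_mem (hN : 3 ≤ N) (hψ : 0 ≤ ψ hi) (hlo0 : 0 ≤ lo)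
    (hlo : lo ≤ hi) (hτ : τ ∈ stdSimplex ℝ (Equiv.Perm (Fin N))) (hb : ∀ j, b j ∈ Icc lo hi) :
    (modifiedThirdPriceAuction ψ lo hi τ).pay b i ∈ Icc 0 hi :=
  (convex_Icc (𝕜 := ℝ) (0 : ℝ) hi).sum_mem (fun σ _ => hτ.1 σ) hτ.2
    fun _ _ => thirdPricePay_mem hN hψ hlo0 hlo hb

lemma thirdPriceAlloc_nonneg : 0 ≤ thirdPriceAlloc ψ lo hi σ b i := by
  unfold thirdPriceAlloc; split_ifs <;> norm_num

lemma exists_position_eq_two (hN : 3 ≤ N) (σ : Equiv.Perm (Fin N)) (b : Fin N → ℝ) :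
    ∃ i, position σ b i = 2 := by
  obtain ⟨i, j, k, h1, h2, h3⟩ := exists_top_three hN σ b
  refine ⟨j, position_eq_two h1 fun l hi hj => ?_⟩
  by_cases hk : l = k
  · exact hk ▸ h2
  · exact h2.trans (h3 l hi hj hk)

lemma sum_thirdPriceAlloc_le_one (hN : 3 ≤ N) : ∑ i, thirdPriceAlloc ψ lo hi σ b i ≤ 1 := by
  by_cases h : IsAllocated ψ lo hi b
  · obtain ⟨w, hw⟩ := exists_position_eq_two hN σ b
    rw [thirdPriceAlloc_of_isAllocated h hw]
    simp
  · rw [thirdPriceAlloc_of_not_isAllocated h]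
    simp

theorem isDirectMechanism_modifiedThirdPriceAuction (hN : 3 ≤ N)
    (h : IsValueDistribution μ f lo hi) (hτ : τ ∈ stdSimplex ℝ (Equiv.Perm (Fin N))) :
    IsDirectMechanism μ lo hi (modifiedThirdPriceAuction (virtualValue μ f) lo hi τ) := by
  have := h.isProbabilityMeasure
  have hψ : 0 ≤ virtualValue μ f hi := by
    rw [h.virtualValue_hi]; exact_mod_cast h.lo_nonneg.trans h.lo_lt_hi.le
  have hlo := h.lo_lt_hi.le
  have hpay : ∀ i, Measurable fun b : Fin N → ℝ =>
      (modifiedThirdPriceAuction (virtualValue μ f) lo hi τ).pay b i := fun i =>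
    Finset.measurable_sum _ fun σ _ =>
      (measurable_thirdPricePay hN hψ hlo h.measurableSet_virtualValue_neg).const_mul _
  refine ⟨fun i => Finset.measurable_sum _ fun σ _ =>
    (measurable_thirdPriceAlloc hN hψ hlo).const_mul _, hpay, ?_, ?_, ?_, ?_⟩
  · exact fun b _ i => Finset.sum_nonneg fun σ _ => mul_nonneg (hτ.1 σ) thirdPriceAlloc_nonneg
  · intro b _
    calc ∑ i, ∑ σ, τ σ * thirdPriceAlloc (virtualValue μ f) lo hi σ b i
        = ∑ σ, τ σ * ∑ i, thirdPriceAlloc (virtualValue μ f) lo hi σ b i := by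
          rw [Finset.sum_comm]
          simp_rw [Finset.mul_sum]
      _ ≤ ∑ σ, τ σ * 1 := Finset.sum_le_sum fun σ _ =>
          mul_le_mul_of_nonneg_left (sum_thirdPriceAlloc_le_one hN) (hτ.1 σ)
      _ = 1 := by simp [hτ.2]
  · intro i
    refine Integrable.of_bound (hpay i).aestronglyMeasurable hi ?_
    filter_upwards [ae_pi_mem h.ae_mem_Icc] with x hx
    have := modifiedThirdPriceAuction_pay_mem (i := i) hN hψ h.lo_nonneg hlo hτ hx
    rw [Real.norm_eq_abs, abs_of_nonneg this.1]
    exact this.2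
  · intro i q hq
    refine Integrable.of_bound ((hpay i).comp measurable_update_left).aestronglyMeasurable hi ?_
    filter_upwards [ae_pi_mem h.ae_mem_Icc] with x hx
    have := modifiedThirdPriceAuction_pay_mem (i := i) hN hψ h.lo_nonneg hlo hτ
      (update_mem_Icc hx hq (i := i))
    rw [Real.norm_eq_abs, abs_of_nonneg this.1]
    exact this.2

/-- An ex post equilibrium of a direct mechanism is a Bayesian Nash equilibrium. -/
lemma IsExPostEquilibrium.isBayesNashEquilibrium {M : Mechanism N} (hN : 3 ≤ N)
    (h : IsValueDistribution μ f lo hi) (hM : IsDirectMechanism μ lo hi M)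
    (hEP : IsExPostEquilibrium lo hi M (truthful N)) :
    IsBayesNashEquilibrium μ lo hi M (truthful N) := by
  have := h.isProbabilityMeasure
  intro i v hv q hq
  refine integral_mono_ae (integrable_interim_payoff hN h hM i hq hv)
    (integrable_interim_payoff hN h hM i hv hv) ?_
  filter_upwards [ae_pi_mem h.ae_mem_Icc] with x hx
  have := hEP (Function.update x i v) (update_mem_Icc hx hv) i q hq
  simp only [truthful, Function.update_idem] at this
  exact this

theorem isFeasible_modifiedThirdPriceAuction (hN : 3 ≤ N)
    (h : IsValueDistribution μ f lo hi) (hτ : τ ∈ stdSimplex ℝ (Equiv.Perm (Fin N))) :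
    IsFeasible μ lo hi (modifiedThirdPriceAuction (virtualValue μ f) lo hi τ) := by
  have := h.isProbabilityMeasure
  have hψ : 0 ≤ virtualValue μ f hi := by
    rw [h.virtualValue_hi]; exact_mod_cast h.lo_nonneg.trans h.lo_lt_hi.le
  have hlo := h.lo_lt_hi.le
  have hM := isDirectMechanism_modifiedThirdPriceAuction hN h hτ
  refine ⟨hM, (isExPostEquilibrium_modifiedThirdPriceAuction hN hψ hlo
    hτ).isBayesNashEquilibrium hN h hM, fun i v hv => ?_⟩
  have hnull := integrable_interim_payoff hN h
    (isDirectMechanism_nullMechanism (N := N)) i hv hv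
  simp only [payoff_nullMechanism] at hnull
  refine integral_mono_ae hnull (integrable_interim_payoff hN h hM i hv hv) ?_
  filter_upwards [ae_pi_mem h.ae_mem_Icc] with x hx
  exact secondPeriodPayoff_none_le_payoff hN hψ hlo hτ (update_mem_Icc hx hv)

lemma interimPayoff_modifiedThirdPriceAuction_lo (hN : 3 ≤ N)
    (h : IsValueDistribution μ f lo hi) (hτ : ∑ σ, τ σ = 1) (i : Fin N) :
    interimPayoff μ (modifiedThirdPriceAuction (virtualValue μ f) lo hi τ) (truthful N) i lo lo
      = 0 := by
  have := h.isProbabilityMeasure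
  have hψ : 0 ≤ virtualValue μ f hi := by
    rw [h.virtualValue_hi]; exact_mod_cast h.lo_nonneg.trans h.lo_lt_hi.le
  have hlo := h.lo_lt_hi.le
  rw [interimPayoff_truthful]
  refine integral_eq_zero_of_ae ?_
  filter_upwards [ae_pi_mem h.ae_mem_Icc] with x hx
  exact payoff_modifiedThirdPriceAuction_eq_zero hN hψ hlo hτ (update_mem_Icc hx ⟨le_rfl, hlo⟩)
    (Function.update_self _ _ _)

end Feasible

/-! ### Optimality -/

section Optimality

variable {N : ℕ} {μ : Measure ℝ} {f : ℝ → ℝ} {lo hi : ℝ} {τ : Equiv.Perm (Fin N) → ℝ}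
  {x : Fin N → ℝ}

lemma IsValueDistribution.virtualValue_mono (h : IsValueDistribution μ f lo hi)
    (hψ : MonotoneOn (virtualValue μ f) (Icc lo hi)) {u v : ℝ} (hu : u ∈ Ioo lo hi)
    (hv : v ∈ Ioo lo hi) (huv : u ≤ v) : u - invHazard μ f u ≤ v - invHazard μ f v := by
  have := hψ (Ioo_subset_Icc_self hu) (Ioo_subset_Icc_self hv) huv
  rw [IsValueDistribution.virtualValue_eq (h.density_pos hψ hu),
    IsValueDistribution.virtualValue_eq (h.density_pos hψ hv)] at this
  exact_mod_cast this

/-- At profiles without ties, the virtual surplus is at most that of the modified third-price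
auction. -/
lemma virtualSurplus_le_optimalRevenueAt (hN : 3 ≤ N) (h : IsValueDistribution μ f lo hi)
    (hψ : MonotoneOn (virtualValue μ f) (Icc lo hi)) (hτ : ∑ σ, τ σ = 1)
    (hx : ∀ j, x j ∈ Ioo lo hi) (hinj : ∀ i j, i ≠ j → x i ≠ x j)
    (hthr : ∀ i j, i ≠ j → x i ≠ threshold (virtualValue μ f) lo hi (x j)) :
    (∀ p : Fin N → ℝ, (∀ j, 0 ≤ p j) → ∑ j, p j ≤ 1 →
      virtualSurplus μ f p x - virtualSurplus μ f 0 x ≤ optimalRevenueAt (virtualValue μ f) x) ∧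
    virtualSurplus μ f ((modifiedThirdPriceAuction (virtualValue μ f) lo hi τ).alloc x) x
      - virtualSurplus μ f 0 x = optimalRevenueAt (virtualValue μ f) x := by
  obtain ⟨i, j, k, rij, rjk, hk⟩ := exists_top_three hN 1 x
  have hlt : ∀ {l m}, RankedAbove 1 x l m → x m < x l := fun {l m} hr =>
    lt_of_le_of_ne hr.le (hinj m l hr.ne.symm)
  have hij := hlt rij
  have hjk := hlt rjk
  have hrest : ∀ l, l ≠ i → l ≠ j → x l ≤ x k := fun l h1 h2 => by
    by_cases h3 : l = k
    · rw [h3]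
    · exact (hk l h1 h2 h3).le
  -- Without ties the priority order is irrelevant, so averaging with `τ` changes nothing.
  have hpos2 : ∀ σ, position σ x j = 2 := fun σ =>
    position_eq_two (rankedAbove_of_lt hij) fun l h1 h2 =>
      rankedAbove_of_lt ((hrest l h1 h2).trans_lt hjk)
  have k2 : kthHighest x 2 = x j := kthHighest_eq_of_position (hpos2 1)
  have k3 : kthHighest x 3 = x k := kthHighest_eq_of_position (position_eq_three rij rjk hk)
  set R := x j - invHazard μ f (x j) + x j - x k with hR
  have hvj := IsValueDistribution.virtualValue_eq (h.density_pos hψ (hx j)) (μ := μ)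
  have hopt : optimalRevenueAt (virtualValue μ f) x = max R 0 := by
    rw [optimalRevenueAt, k2, k3, hvj, ← EReal.coe_add, ← EReal.coe_zero, ← EReal.coe_strictMono.monotone.map_max,
      EReal.toReal_coe, hR]
    congr 1
    ring
  have hgain : ∀ l, gain μ f x l ≤ R := fun l => by
    by_cases hli : l = i
    · rw [hli, gain_of_top hij hjk hrest]
    by_cases hlj : l = j
    · rw [hlj, gain_of_second hij hjk hrest]
    rw [gain_of_low hij hjk hrest hli hlj]
    have := h.virtualValue_mono hψ (hx l) (hx j) ((hrest l hli hlj).trans hjk.le)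
    linarith
  have hmem : x j ∈ thresholdSet (virtualValue μ f) lo hi (x k) ↔ 0 ≤ R := by
    rw [thresholdSet, mem_ofPred_eq, hvj, ← EReal.coe_add, EReal.coe_le_coe_iff]
    constructor
    · rintro ⟨-, -, h3⟩; linarith
    · intro h3; exact ⟨Ioo_subset_Icc_self (hx j), hjk.le, by linarith⟩
  have hA : IsAllocated (virtualValue μ f) lo hi x ↔ 0 ≤ R := by
    rw [IsAllocated, k2, k3, ← hmem]
    constructor
    · intro hle
      -- Excluding equality with the threshold avoids proving that the infimum is attained: some `a
      -- < x j` satisfies the condition, and monotonicity of `ψ` passes it on to `x j`.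
      have hlt := lt_of_le_of_ne hle (hthr j k rjk.ne).symm
      have hψhi : 0 ≤ virtualValue μ f hi := by
        rw [h.virtualValue_hi]; exact_mod_cast h.lo_nonneg.trans h.lo_lt_hi.le
      obtain ⟨a, ha, haj⟩ := exists_lt_of_csInf_lt
        (thresholdSet_nonempty hψhi (hx k).2.le h.lo_lt_hi.le) hlt
      refine ⟨Ioo_subset_Icc_self (hx j), hjk.le, ha.2.2.trans ?_⟩
      have h1 : (a : EReal) ≤ (x j : EReal) := by exact_mod_cast haj.le
      exact add_le_add h1 (hψ ha.1 (Ioo_subset_Icc_self (hx j)) haj.le)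
    · exact threshold_le_of_mem
  constructor
  · intro p hp hs
    rw [virtualSurplus_sub, hopt]
    calc ∑ l, p l * gain μ f x l ≤ ∑ l, p l * max R 0 := Finset.sum_le_sum fun l _ =>
          mul_le_mul_of_nonneg_left ((hgain l).trans (le_max_left _ _)) (hp l)
      _ = (∑ l, p l) * max R 0 := by rw [Finset.sum_mul]
      _ ≤ 1 * max R 0 := mul_le_mul_of_nonneg_right hs (le_max_right _ _)
      _ = max R 0 := one_mul _
  · have hsum : ∀ l, (modifiedThirdPriceAuction (virtualValue μ f) lo hi τ).alloc x l
        = ∑ σ, τ σ * thirdPriceAlloc (virtualValue μ f) lo hi σ x l := fun l => rfl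
    rw [virtualSurplus_sub, hopt]
    by_cases hc : IsAllocated (virtualValue μ f) lo hi x
    · simp_rw [hsum, thirdPriceAlloc_of_isAllocated hc (hpos2 _), ← Finset.sum_mul, hτ, one_mul]
      rw [max_eq_left (hA.1 hc), Fintype.sum_eq_single j fun l hl => by simp [hl],
        Pi.single_eq_same, one_mul, gain_of_second hij hjk hrest]
    · simp_rw [hsum, thirdPriceAlloc_of_not_isAllocated hc]
      rw [max_eq_right (not_le.1 (mt hA.2 hc)).le]
      simp

/-- As `μ` has no atoms, endpoint values, ties, and values equal to a rival's threshold all occur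
with probability zero. -/
lemma ae_virtualSurplus_le_optimalRevenueAt (hN : 3 ≤ N) (h : IsValueDistribution μ f lo hi)
    (hψ : MonotoneOn (virtualValue μ f) (Icc lo hi)) (hτ : ∑ σ, τ σ = 1) :
    ∀ᵐ x ∂(Measure.pi fun _ : Fin N => μ),
    (∀ p : Fin N → ℝ, (∀ j, 0 ≤ p j) → ∑ j, p j ≤ 1 →
      virtualSurplus μ f p x - virtualSurplus μ f 0 x ≤ optimalRevenueAt (virtualValue μ f) x) ∧
    virtualSurplus μ f ((modifiedThirdPriceAuction (virtualValue μ f) lo hi τ).alloc x) x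
      - virtualSurplus μ f 0 x = optimalRevenueAt (virtualValue μ f) x := by
  have := h.isProbabilityMeasure
  have := h.nullSingletonClass
  have hψhi : 0 ≤ virtualValue μ f hi := by
    rw [h.virtualValue_hi]; exact_mod_cast h.lo_nonneg.trans h.lo_lt_hi.le
  have key : ∀ g : ℝ → ℝ, Measurable g →
      ∀ᵐ x ∂(Measure.pi fun _ : Fin N => μ), ∀ i j, i ≠ j → x i ≠ g (x j) := by
    intro g hg
    rw [ae_all_iff]; intro i
    rw [ae_all_iff]; intro j
    by_cases hij : i = j
    · exact Filter.Eventually.of_forall fun x hne => absurd hij hne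
    · filter_upwards [ae_ne_of_measurable hg hij] with x hx _ using hx
  filter_upwards [ae_pi_mem h.ae_mem_Ioo, key id measurable_id,
    key _ (measurable_threshold hψhi h.lo_lt_hi.le)] with x h1 h2 h3
  exact virtualSurplus_le_optimalRevenueAt hN h hψ hτ h1 h2 h3

end Optimality

end SequentialAuction

end

open SequentialAuction in
theorem theorem5 (N : ℕ) (hN : 3 ≤ N) (μ : Measure ℝ) (f : ℝ → ℝ) (lo hi : ℝ)
    (hμ : IsValueDistribution μ f lo hi)
    (hψ : MonotoneOn (virtualValue μ f) (Icc lo hi))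
    (τ : Equiv.Perm (Fin N) → ℝ) (hτ : τ ∈ stdSimplex ℝ (Equiv.Perm (Fin N)))
    (M : Mechanism N) (hM : M = modifiedThirdPriceAuction (virtualValue μ f) lo hi τ) :
    IsExPostEquilibrium lo hi M (truthful N) ∧
    IsBayesNashEquilibrium μ lo hi M (truthful N) ∧
    Integrable (fun x : Fin N → ℝ => optimalRevenueAt (virtualValue μ f) x)
      (Measure.pi fun _ : Fin N => μ) ∧
    expectedRevenue μ M =
      ∫ x, optimalRevenueAt (virtualValue μ f) x ∂(Measure.pi fun _ : Fin N => μ) ∧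
    IsFeasible μ lo hi M ∧
    ∀ M' : Mechanism N, IsFeasible μ lo hi M' → expectedRevenue μ M' ≤ expectedRevenue μ M := by
  have := hμ.isProbabilityMeasure
  have hψhi : 0 ≤ virtualValue μ f hi := by
    rw [hμ.virtualValue_hi]; exact_mod_cast hμ.lo_nonneg.trans hμ.lo_lt_hi.le
  have hfeas : IsFeasible μ lo hi M := hM ▸ isFeasible_modifiedThirdPriceAuction hN hμ hτ
  have hEP : IsExPostEquilibrium lo hi M (truthful N) :=
    hM ▸ isExPostEquilibrium_modifiedThirdPriceAuction hN hψhi hμ.lo_lt_hi.le hτ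
  have hae := ae_virtualSurplus_le_optimalRevenueAt hN hμ hψ hτ.2
  rw [← hM] at hae
  have hsub : ∀ M' : Mechanism N, IsDirectMechanism μ lo hi M' → Integrable
      (fun x => virtualSurplus μ f (M'.alloc x) x - virtualSurplus μ f 0 x)
      (Measure.pi fun _ : Fin N => μ) := fun M' hM' =>
    (integrable_virtualSurplus hN hμ hM').sub (integrable_virtualSurplus_zero hN hμ)
  have heq := hae.mono fun x hx => hx.2
  -- Finiteness comes for free: the integrand agrees almost everywhere with a difference of
  -- integrable virtual surpluses.
  have hopt : Integrable (fun x : Fin N → ℝ => optimalRevenueAt (virtualValue μ f) x)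
      (Measure.pi fun _ : Fin N => μ) := (hsub M hfeas.isDirectMechanism).congr heq
  have hrev : expectedRevenue μ M =
      ∫ x, optimalRevenueAt (virtualValue μ f) x ∂(Measure.pi fun _ : Fin N => μ) := by
    rw [expectedRevenue_eq hN hμ hψ hfeas.isDirectMechanism hfeas.incentiveCompatible,
      integral_congr_ae heq, Finset.sum_eq_zero, sub_zero]
    intro i _
    rw [hM]
    exact interimPayoff_modifiedThirdPriceAuction_lo hN hμ hτ.2 i
  refine ⟨hEP, hfeas.incentiveCompatible, hopt, hrev, hfeas, fun M' hM' => ?_⟩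
  rw [hrev, expectedRevenue_eq hN hμ hψ hM'.isDirectMechanism hM'.incentiveCompatible]
  have hIR : 0 ≤ ∑ i, interimPayoff μ M' (truthful N) i lo lo :=
    Finset.sum_nonneg fun i _ => by
      have := hM'.individuallyRational i lo ⟨le_rfl, hμ.lo_lt_hi.le⟩
      rwa [integral_secondPeriodPayoff_lo hN hμ] at this
  -- Drop the nonnegative payoffs of the lowest types, then bound the gain in virtual surplus
  -- pointwise.
  refine (sub_le_self _ hIR).trans
    (integral_mono_ae (hsub M' hM'.isDirectMechanism) hopt ?_)
  filter_upwards [hae, ae_pi_mem hμ.ae_mem_Icc] with x hx hmem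
  exact hx.1 _ (hM'.isDirectMechanism.alloc_nonneg x hmem)
    (hM'.isDirectMechanism.sum_alloc_le_one x hmem)
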